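/- Let $u:\prod_{i=1}^N S_i\to\mathbb R^N$ be a game with $N$ players and finite strategy sets $S_1,\dots,S_N$, let $X=\prod_{i=1}^N\Delta(S_i)$ be its space of mixed profiles, and let $\phi:X\times\mathbb R\to X$ be the replicator flow of $u$, that is, the flow on $X$ defined by the solutions of \[ \dot x^p_s = x^p_s\Bigl(\mathbb U_p(s;x_{-p})-\sum_{t\in S_p}x^p_t\,\mathbb U_p(t;x_{-p})\Bigr),\qquad p\in\{1,\dots,N\},\ s\in S_p, \] where $\mathbb U_p(x)=\sum_q u_p(q)\prod_i x^i_{q_i}$ is the expected utility of player $p$, and $\mathbb U_p(s;x_{-p})$ is its value when player $p$ switches to the pure strategy $s$. The response graph of $u$ is the directed graph on the pure profiles with an arc $p\to q$ whenever $p$ and $q$ differ in the strategy of exactly one player $i$ and $u_i(p)\le u_i(q)$. For $\epsilon,T>0$, an $(\epsilon,T)$-chain from $x$ to $y$ is a sequence $x=x_1,x_2,\dots,x_n=y$ in $X$, $n\ge 2$, with times $t_1,\dots,t_{n-1}\ge T$ such that $d(\phi(x_k,t_k),x_{k+1})<\epsilon$ for $1\le k\le n-1$. Points $x,y$ are chain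 equivalent if for all $\epsilon,T>0$ there are $(\epsilon,T)$-chains from $x$ to $y$ and from $y$ to $x$; $x$ is chain recurrent if it is chain equivalent to itself; a chain component is the chain equivalence class of a chain recurrent point. The content of a set $W$ of pure profiles is the set of all mixed profiles $x$ such that every pure profile in the support of $x$ (every $q$ with $x^i_{q_i}>0$ for all $i$) belongs to $W$. Theorem (content containment). Let $H$ be a strongly connected component of the response graph of $u$. Then there is exactly one chain component $[H]$ of the replicator flow that contains all pure profiles in $H$, and the content of $H$ is contained in $[H]$. -/

import Mathlib

/-!
# Games, response graphs, the replicator flow and its chain components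

A game has a finite type `ι` of players, finite strategy types `S i`, and a utility function
`u : (∀ i, S i) → ι → ℝ`, where `u q i` is the payoff of player `i` in the pure profile `q`.
-/

namespace ReplicatorGame

open Set

section ResponseGraph

variable {ι : Type*} {S : ι → Type*}

/-- `p` and `q` are `i`-comparable: they differ in the strategy of player `i` only. -/
def Comparable (i : ι) (p q : ∀ i, S i) : Prop :=
  p i ≠ q i ∧ ∀ j, j ≠ i → p j = q j

/-- The response graph: an arc `p → q` whenever `p` and `q` are `i`-comparable for some player `i`
and `u_i(p) ≤ u_i(q)`. -/
def responseGraph (u : (∀ i, S i) → ι → ℝ) : Digraph (∀ i, S i) where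
  Adj p q := ∃ i, Comparable i p q ∧ u p i ≤ u q i

/-- There is a directed path (possibly of length zero) from `p` to `q`. -/
def Reachable {V : Type*} (G : Digraph V) (p q : V) : Prop :=
  Relation.ReflTransGen G.Adj p q

/-- `H` is a strongly connected component: a class of mutually reachable vertices. -/
def IsStronglyConnectedComponent {V : Type*} (G : Digraph V) (H : Set V) : Prop :=
  ∃ p, H = {q | Reachable G p q ∧ Reachable G q p}

end ResponseGraph

section MixedProfiles

variable {ι : Type*} {S : ι → Type*} [∀ i, Fintype (S i)]

variable (S) in
/-- The strategy space `X = ∏ᵢ Δ(Sᵢ)`. -/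
def strategySpace : Set (∀ i, S i → ℝ) :=
  {x | ∀ i, x i ∈ stdSimplex ℝ (S i)}

/-- The pure profile `q`, seen as a mixed profile. -/
def pureProfile [∀ i, DecidableEq (S i)] (q : ∀ i, S i) : strategySpace S :=
  ⟨fun i => Pi.single (q i) 1, fun i => single_mem_stdSimplex ℝ (q i)⟩

/-- The content of a set `W` of pure profiles: all mixed profiles `x` such that every pure profile
in the support of `x` belongs to `W`. -/
def content (W : Set (∀ i, S i)) : Set (strategySpace S) :=
  {x | ∀ q : ∀ i, S i, (∀ i, 0 < x.1 i (q i)) → q ∈ W}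

theorem norm_le_one_of_mem_strategySpace [Fintype ι] {x : ∀ i, S i → ℝ} (hx : x ∈ strategySpace S) :
    ‖x‖ ≤ 1 := by
  rw [pi_norm_le_iff_of_nonneg zero_le_one]
  intro i
  rw [pi_norm_le_iff_of_nonneg zero_le_one]
  intro s
  rw [Real.norm_of_nonneg ((hx i).1 s), ← (hx i).2]
  exact Finset.single_le_sum (fun t _ => (hx i).1 t) (Finset.mem_univ s)

end MixedProfiles

section Chains

variable {X : Type*} [MetricSpace X]

/-- There is an `(ε, T)`-chain from `x` to `y` (with at least one step): every step from `a` to `b`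
follows the flow for some time `t ≥ T` and then jumps by less than `ε`. -/
def HasChain (φ : Flow ℝ X) (ε T : ℝ) (x y : X) : Prop :=
  Relation.TransGen (fun a b => ∃ t, T ≤ t ∧ dist (φ t a) b < ε) x y

/-- There is a pseudo-orbit from `x` to `y`. -/
def PseudoOrbit (φ : Flow ℝ X) (x y : X) : Prop :=
  ∀ ε > 0, ∀ T > 0, HasChain φ ε T x y

/-- `x` and `y` are chain equivalent. -/
def ChainEquiv (φ : Flow ℝ X) (x y : X) : Prop :=
  PseudoOrbit φ x y ∧ PseudoOrbit φ y x

/-- `x` is chain recurrent. -/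
def ChainRecurrent (φ : Flow ℝ X) (x : X) : Prop :=
  ChainEquiv φ x x

/-- `C` is a chain component: the chain equivalence class of a chain recurrent point. -/
def IsChainComponent (φ : Flow ℝ X) (C : Set X) : Prop :=
  ∃ x, ChainRecurrent φ x ∧ C = {y | ChainEquiv φ x y}

end Chains

section Replicator

variable {ι : Type*} [Fintype ι] [DecidableEq ι]
  {S : ι → Type*} [∀ i, Fintype (S i)] [∀ i, DecidableEq (S i)]

/-- The expected utility `𝕌_p(x) = ∑_q u_p(q) ∏ᵢ xⁱ_{qᵢ}` of player `p`. -/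
def expectedUtility (u : (∀ i, S i) → ι → ℝ) (p : ι) (x : ∀ i, S i → ℝ) : ℝ :=
  ∑ q : ∀ i, S i, u q p * ∏ i, x i (q i)

/-- `𝕌_p(s; x_{-p})`: player `p` switches to the pure strategy `s`. -/
def deviationUtility (u : (∀ i, S i) → ι → ℝ) (p : ι) (s : S p) (x : ∀ i, S i → ℝ) : ℝ :=
  expectedUtility u p (Function.update x p (Pi.single s 1))

/-- The right-hand side of the replicator equation. -/
def replicatorField (u : (∀ i, S i) → ι → ℝ) (x : ∀ i, S i → ℝ) : ∀ i, S i → ℝ :=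
  fun p s => x p s *
    (deviationUtility u p s x - ∑ t, x p t * deviationUtility u p t x)

/-- `φ` is the flow on the strategy space whose orbits are the solutions of the replicator
equation. -/
def IsReplicatorFlow (u : (∀ i, S i) → ι → ℝ) (φ : Flow ℝ (strategySpace S)) : Prop :=
  ∀ (x : strategySpace S) (t : ℝ),
    HasDerivAt (fun τ => (φ τ x : ∀ i, S i → ℝ)) (replicatorField u (φ t x)) t

/-! ### The replicator equation has exactly one flow -/

/-- A bounded, globally Lipschitz vector field has a continuous global flow. -/
theorem exists_global_flow {E : Type*} [NormedAddCommGroup E] [NormedSpace ℝ E] [CompleteSpace E]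
    {G : E → E} {K L : NNReal} (hK : LipschitzWith K G) (hL : ∀ x, ‖G x‖ ≤ L) :
    ∃ Φ : Flow ℝ E, ∀ x t, HasDerivAt (fun τ => Φ τ x) (G (Φ t x)) t := by
  have hPL : ∀ (x : E) (T : NNReal) , IsPicardLindelof (fun _ => G)
      (⟨0, by constructor <;> simp⟩ : Icc (-(T : ℝ)) T) x (L * T + 1) 1 L K := by
    intro x T
    refine ⟨fun _ _ => hK.lipschitzOnWith, fun _ _ => continuousOn_const,
      fun _ _ x _ => hL x, ?_⟩
    simp
  have hloc : ∀ (x : E) (n : ℕ), ∃ α : ℝ → E, α 0 = x ∧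
      ∀ t ∈ Ioo (-(n : ℝ)) n, HasDerivAt α (G (α t)) t := by
    intro x n
    obtain ⟨α, h0, hα⟩ := (hPL x n).exists_eq_forall_mem_Icc_hasDerivWithinAt
      (Metric.mem_closedBall_self (by simp))
    refine ⟨α, h0, fun t ht => ?_⟩
    have := hα t (by simpa using Ioo_subset_Icc_self ht)
    exact this.hasDerivAt (by simpa using Icc_mem_nhds ht.1 ht.2)
  choose α hα0 hα using hloc
  have huniq : ∀ (a : ℝ) (f g : ℝ → E), f 0 = g 0 →
      (∀ t ∈ Ioo (-a) a, HasDerivAt f (G (f t)) t) →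
      (∀ t ∈ Ioo (-a) a, HasDerivAt g (G (g t)) t) → ∀ t ∈ Ioo (-a) a, f t = g t := by
    intro a f g h0 hf hg t ht
    have ha : (0 : ℝ) ∈ Ioo (-a) a := by
      have := ht.1.trans ht.2
      constructor <;> linarith
    exact ODE_solution_unique_of_mem_Ioo (v := fun _ => G) (s := fun _ => univ) (K := K)
      (fun _ _ => hK.lipschitzOnWith) ha
      (fun t ht => ⟨hf t ht, trivial⟩) (fun t ht => ⟨hg t ht, trivial⟩) h0 ht
  let Φ : ℝ → E → E := fun t x => α x (⌈|t|⌉₊ + 1) t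
  have hmem : ∀ t : ℝ, t ∈ Ioo (-((⌈|t|⌉₊ + 1 : ℕ) : ℝ)) ((⌈|t|⌉₊ + 1 : ℕ) : ℝ) := by
    intro t
    have := Nat.le_ceil |t|
    rw [mem_Ioo, ← abs_lt]
    push_cast
    linarith
  have hΦα : ∀ (x : E) (n : ℕ), ∀ t ∈ Ioo (-(n : ℝ)) n, Φ t x = α x n t := by
    intro x n t ht
    have h1 := abs_lt.2 (hmem t)
    have h2 := abs_lt.2 ht
    rcases le_total n (⌈|t|⌉₊ + 1) with h | h
    · have h' : (n : ℝ) ≤ ((⌈|t|⌉₊ + 1 : ℕ) : ℝ) := by exact_mod_cast h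
      refine huniq n _ _ (by rw [hα0, hα0]) (fun s hs => hα x _ s ?_) (hα x n) t ht
      exact ⟨by linarith [hs.1], by linarith [hs.2]⟩
    · have h' : ((⌈|t|⌉₊ + 1 : ℕ) : ℝ) ≤ (n : ℝ) := by exact_mod_cast h
      refine huniq _ _ _ (by rw [hα0, hα0]) (hα x _) (fun s hs => hα x n s ?_) t (hmem t)
      exact ⟨by linarith [hs.1], by linarith [hs.2]⟩
  have hderiv : ∀ x t, HasDerivAt (fun τ => Φ τ x) (G (Φ t x)) t := by
    intro x t
    refine (hα x _ t (hmem t)).congr_of_eventuallyEq ?_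
    filter_upwards [Ioo_mem_nhds (hmem t).1 (hmem t).2] with s hs using hΦα x _ s hs
  have hzero : ∀ x, Φ 0 x = x := fun x => hα0 x _
  have hcont : Continuous (Function.uncurry Φ) := by
    rw [continuous_iff_continuousAt]
    rintro ⟨t₀, x₀⟩
    set T : ℕ := ⌈|t₀|⌉₊ + 1 with hT
    obtain ⟨β, hβ, hβc⟩ :=
      (hPL x₀ T).exists_forall_mem_closedBall_eq_hasDerivWithinAt_continuousOn
    have hnb : Metric.ball x₀ 1 ×ˢ Ioo (-(T : ℝ)) T ∈ nhds (x₀, t₀) :=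
      prod_mem_nhds (Metric.ball_mem_nhds _ one_pos) (Ioo_mem_nhds (hmem t₀).1 (hmem t₀).2)
    have hβat : ContinuousAt β (x₀, t₀) := by
      refine hβc.continuousAt (Filter.mem_of_superset hnb ?_)
      exact prod_mono (by simpa using Metric.ball_subset_closedBall)
        (by simpa using Ioo_subset_Icc_self)
    have hsw : ContinuousAt (fun p : ℝ × E => β (p.2, p.1)) (t₀, x₀) :=
      ContinuousAt.comp (f := fun p : ℝ × E => (p.2, p.1)) (g := β) hβat
        (continuous_swap.continuousAt)
    refine hsw.congr ?_
    have hnb' : Ioo (-(T : ℝ)) T ×ˢ Metric.ball x₀ 1 ∈ nhds (t₀, x₀) :=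
      prod_mem_nhds (Ioo_mem_nhds (hmem t₀).1 (hmem t₀).2) (Metric.ball_mem_nhds _ one_pos)
    filter_upwards [hnb'] with p hp
    obtain ⟨hβ0, hβd⟩ := hβ p.2 (by simpa using Metric.ball_subset_closedBall hp.2)
    refine huniq T (fun t => β (p.2, t)) (fun t => Φ t p.2) ?_ ?_ (fun t _ => hderiv _ t) p.1 hp.1
    · simpa [hzero] using hβ0
    · intro t ht
      exact (hβd t (by simpa using Ioo_subset_Icc_self ht)).hasDerivAt
        (by simpa using Icc_mem_nhds ht.1 ht.2)
  refine ⟨⟨Φ, hcont, ?_, hzero⟩, hderiv⟩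
  intro t₁ t₂ x
  refine huniq (|t₁| + 1) (fun t => Φ (t + t₂) x) (fun t => Φ t (Φ t₂ x)) ?_ ?_
    (fun t _ => hderiv _ t) t₁ (abs_lt.1 (by linarith))
  · simp [hzero]
  · intro t _
    exact (hderiv x (t + t₂)).comp_add_const t t₂

theorem contDiff_replicatorField (u : (∀ i, S i) → ι → ℝ) :
    ContDiff ℝ 1 (replicatorField u) := by
  have hd : ∀ (p : ι) (s : S p), ContDiff ℝ 1 (deviationUtility u p s) := by
    intro p s
    unfold deviationUtility expectedUtility
    refine ContDiff.sum fun q _ => contDiff_const.mul (contDiff_prod fun i _ => ?_)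
    by_cases h : i = p
    · subst h
      simpa using contDiff_const
    · simp only [Function.update_of_ne h]
      exact contDiff_pi.1 (contDiff_pi.1 contDiff_id i) (q i)
  have hc : ∀ (p : ι) (s : S p), ContDiff ℝ 1 (fun x : ∀ i, S i → ℝ => x p s) := by
    intro p s
    exact contDiff_pi.1 (contDiff_pi.1 contDiff_id p) s
  rw [contDiff_pi]
  intro p
  rw [contDiff_pi]
  intro s
  exact (hc p s).mul ((hd p s).sub (ContDiff.sum fun t _ => (hc p t).mul (hd p t)))

/-- The solutions of a scalar homogeneous linear equation. -/
theorem linear_solution {a y : ℝ → ℝ} (ha : Continuous a)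
    (hy : ∀ t, HasDerivAt y (a t * y t) t) : ∀ t, y t = y 0 * Real.exp (∫ s in 0..t, a s) := by
  have hA : ∀ t, HasDerivAt (fun t => ∫ s in 0..t, a s) (a t) t := fun t =>
    intervalIntegral.integral_hasDerivAt_right (ha.intervalIntegrable _ _)
      (ha.stronglyMeasurableAtFilter _ _) ha.continuousAt
  have hz : ∀ t, HasDerivAt (fun t => y t * Real.exp (-∫ s in 0..t, a s)) 0 t := by
    intro t
    have := (hy t).mul (hA t).neg.exp
    refine this.congr_deriv ?_
    simp only [mul_neg]
    ring
  intro t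
  have h := is_const_of_deriv_eq_zero (fun t => (hz t).differentiableAt) (fun t => (hz t).deriv) t 0
  simp only [intervalIntegral.integral_same, neg_zero, Real.exp_zero, mul_one, Real.exp_neg] at h
  rw [← h]
  field_simp

theorem exists_isReplicatorFlow (u : (∀ i, S i) → ι → ℝ) :
    ∃ φ : Flow ℝ (strategySpace S), IsReplicatorFlow u φ := by
  let χ : ContDiffBump (0 : ∀ i, S i → ℝ) := ⟨1, 2, one_pos, one_lt_two⟩
  let G : (∀ i, S i → ℝ) → (∀ i, S i → ℝ) := fun x => χ x • replicatorField u x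
  have hX : ∀ x ∈ strategySpace S, G x = replicatorField u x := by
    intro x hx
    have : χ x = 1 := χ.one_of_mem_closedBall
      (mem_closedBall_zero_iff.2 (norm_le_one_of_mem_strategySpace hx))
    simp [G, this]
  have hGs : HasCompactSupport G := χ.hasCompactSupport.smul_right
  have hGd : ContDiff ℝ 1 G := χ.contDiff.smul (contDiff_replicatorField u)
  obtain ⟨K, hK⟩ := ContDiff.lipschitzWith_of_hasCompactSupport hGs hGd one_ne_zero
  obtain ⟨L, hL⟩ := hGs.exists_bound_of_continuous hGd.continuous
  obtain ⟨Φ, hΦ⟩ := exists_global_flow (L := L.toNNReal) hK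
    (fun x => (hL x).trans (Real.le_coe_toNNReal L))
  have hcd : ∀ p (s : S p), Continuous (deviationUtility u p s) := by
    intro p s
    unfold deviationUtility expectedUtility
    refine continuous_finsetSum _ fun q _ => continuous_const.mul
      (continuous_finsetProd _ fun i _ => ?_)
    by_cases h : i = p
    · subst h
      simpa using continuous_const
    · simp only [Function.update_of_ne h]
      fun_prop
  have hΦc : ∀ x, Continuous fun t => Φ t x := fun x =>
    continuous_iff_continuousAt.2 fun t => (hΦ x t).continuousAt
  have hcomp : ∀ x (p : ι) (s : S p) t, HasDerivAt (fun τ => Φ τ x p s)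
      (χ (Φ t x) * replicatorField u (Φ t x) p s) t := fun x p s t =>
    hasDerivAt_pi.1 (hasDerivAt_pi.1 (hΦ x t) p) s
  have hχc : ∀ x, Continuous fun t => χ (Φ t x) := fun x => χ.continuous.comp (hΦc x)
  have hcoord : ∀ x (p : ι) (s : S p), Continuous fun t => Φ t x p s := fun x p s =>
    (continuous_apply s).comp ((continuous_apply p).comp (hΦc x))
  have hdev : ∀ x (p : ι) (s : S p), Continuous fun t => deviationUtility u p s (Φ t x) :=
    fun x p s => (hcd p s).comp (hΦc x)
  have hinv : ∀ x ∈ strategySpace S, ∀ t, Φ t x ∈ strategySpace S := by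
    intro x hx t p
    have hm : Continuous fun t => ∑ r, Φ t x p r * deviationUtility u p r (Φ t x) :=
      continuous_finsetSum _ fun r _ => (hcoord x p r).mul (hdev x p r)
    constructor
    · intro s
      have h := linear_solution (y := fun t => Φ t x p s)
        (a := fun t => χ (Φ t x) * (deviationUtility u p s (Φ t x) -
          ∑ r, Φ t x p r * deviationUtility u p r (Φ t x)))
        ((hχc x).mul ((hdev x p s).sub hm))
        (fun t => by
          convert hcomp x p s t using 1
          simp only [replicatorField]
          ring) t
      rw [h, Φ.map_zero_apply]
      exact mul_nonneg ((hx p).1 s) (Real.exp_pos _).le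
    · have h := linear_solution (y := fun t => (∑ s, Φ t x p s) - 1)
        (a := fun t => -(χ (Φ t x) * ∑ r, Φ t x p r * deviationUtility u p r (Φ t x)))
        ((hχc x).mul hm).neg
        (fun t => by
          have := (HasDerivAt.fun_sum (u := Finset.univ)
            (fun s _ => hcomp x p s t)).sub_const 1
          refine this.congr_deriv ?_
          simp only [replicatorField]
          rw [← Finset.mul_sum]
          simp only [mul_sub, Finset.sum_sub_distrib]
          rw [← Finset.sum_mul]
          ring) t
      rw [Φ.map_zero_apply, (hx p).2] at h
      simp only [sub_self, zero_mul] at h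
      linarith
  refine ⟨⟨fun t x => ⟨Φ t x, hinv x x.2 t⟩, ?_, ?_, ?_⟩, ?_⟩
  · refine Continuous.subtype_mk ?_ _
    exact Φ.cont'.comp (continuous_fst.prodMk (continuous_subtype_val.comp continuous_snd))
  · exact fun t₁ t₂ x => Subtype.ext (Φ.map_add' t₁ t₂ x)
  · exact fun x => Subtype.ext (Φ.map_zero' x)
  · intro x t
    have := hΦ x t
    rw [hX _ (hinv x x.2 t)] at this
    exact this

theorem IsReplicatorFlow.unique {u : (∀ i, S i) → ι → ℝ} {φ ψ : Flow ℝ (strategySpace S)}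
    (hφ : IsReplicatorFlow u φ) (hψ : IsReplicatorFlow u ψ) : φ = ψ := by
  let χ : ContDiffBump (0 : ∀ i, S i → ℝ) := ⟨1, 2, one_pos, one_lt_two⟩
  have hK : ∃ K, LipschitzWith K fun x => χ x • replicatorField u x :=
    ContDiff.lipschitzWith_of_hasCompactSupport χ.hasCompactSupport.smul_right
      (χ.contDiff.smul (contDiff_replicatorField u)) one_ne_zero
  obtain ⟨K, hK⟩ := hK
  have hX : ∀ x ∈ strategySpace S, χ x • replicatorField u x = replicatorField u x := by
    intro x hx
    have : χ x = 1 := χ.one_of_mem_closedBall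
      (mem_closedBall_zero_iff.2 (norm_le_one_of_mem_strategySpace hx))
    simp [this]
  ext1 t x
  refine Subtype.ext (congrFun (ODE_solution_unique_univ
    (v := fun _ x => χ x • replicatorField u x) (s := fun _ => univ) (K := K) (t₀ := 0)
    (f := fun t => (φ t x : ∀ i, S i → ℝ)) (g := fun t => (ψ t x : ∀ i, S i → ℝ))
    (fun _ => hK.lipschitzOnWith) (fun t => ⟨?_, trivial⟩) (fun t => ⟨?_, trivial⟩) (by simp)) t)
  · rw [hX _ (φ t x).2]
    exact hφ x t
  · rw [hX _ (ψ t x).2]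
    exact hψ x t

/-- The replicator flow of the game `u`. -/
noncomputable def replicatorFlow (u : (∀ i, S i) → ι → ℝ) : Flow ℝ (strategySpace S) :=
  (exists_isReplicatorFlow u).choose

theorem isReplicatorFlow_replicatorFlow (u : (∀ i, S i) → ι → ℝ) :
    IsReplicatorFlow u (replicatorFlow u) :=
  (exists_isReplicatorFlow u).choose_spec

end Replicator

end ReplicatorGame

/-! An arc of the response graph gives a pseudo-orbit between its ends. The edge of the strategy
space joining them is invariant, and the replicator equation on it is logistic with the sign of the
payoff difference. Small jumps can therefore climb the edge without being pushed back
(`pseudoOrbit_of_le`). Hence the pure profiles of a strongly connected component are mutually chain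
equivalent, and exactly one chain class contains them.

For a point `x` of the content it remains to find, for all `ε` and `T`, chains from `x` to some pure
profile in its support and from some such profile to `x`. This rests on volume preservation. In
logarithmic coordinates on the relative interior of a face, the velocity in direction `(i, s)` is a
payoff difference that does not involve the mixture of player `i`, so the field is divergence free.

The set `U` of points reached by chains from `x` contains the `ε`-neighbourhood of its image under
the time-`T` map. In the closure of `U`, within the face of `x`, choose a point `z` of minimal
support. The part `K` of the closure in the face of `z` is then compact and lies in the relative
interior, so it has no room to be mapped strictly inside itself. A bump function around the image of
`K` does not decrease along the map and keeps its integral, so it is invariant (`eq_of_le`).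
Connectedness makes `K` the whole relative interior, and compactness puts the vertices of the face
into `K`. Vertices are fixed, so they lie in `U` (`exists_pureProfile_mem`). Reversing time gives
the chains in the other direction.

The chart is `softmax` on the full space of real vectors. It forgets one additive constant per
player and all coordinates off the support. These stay as free parameters, controlled by `cutoff`,
so that Lebesgue measure can be used directly. -/

namespace ReplicatorGame

open Set MeasureTheory

/-! ### Integration of derivatives along divergence-free Lipschitz fields. -/

section DivergenceFree

variable {E : Type*} [NormedAddCommGroup E] [NormedSpace ℝ E] [FiniteDimensional ℝ E]
  [MeasurableSpace E] [BorelSpace E] {μ : Measure E} [μ.IsAddHaarMeasure]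

/-- Integration by parts moves the derivative onto `W`, which is constant along `e`. -/
theorem integral_lineDeriv_mul_eq_zero {h W : E → ℝ} {C D : NNReal} {e : E}
    (hh : LipschitzWith C h) (hs : HasCompactSupport h) (hW : LipschitzWith D W)
    (hinv : ∀ (y : E) (t : ℝ), W (y + t • e) = W y) :
    ∫ y, lineDeriv ℝ h y e * W y ∂μ = 0 := by
  have h1 := LipschitzWith.integral_lineDeriv_mul_eq (μ := μ) hW hh hs (-e)
  rw [neg_neg] at h1
  rw [← h1]
  have h2 : ∀ y, lineDeriv ℝ W y (-e) = 0 := by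
    intro y
    have : (fun t : ℝ => W (y + t • -e)) = fun _ => W y := by
      funext t
      rw [smul_neg, ← neg_smul]
      exact hinv y (-t)
    rw [lineDeriv, this, deriv_const]
  simp [h2]

theorem integrable_lineDeriv_mul {h W : E → ℝ} {C : NNReal} {e : E}
    (hh : LipschitzWith C h) (hs : HasCompactSupport h) (hW : Continuous W) :
    Integrable (fun y => lineDeriv ℝ h y e * W y) μ := by
  have hsup : ∀ y ∉ tsupport h, lineDeriv ℝ h y e = 0 := by
    intro y hy
    have : h =ᶠ[nhds y] fun _ => 0 := notMem_tsupport_iff_eventuallyEq.1 hy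
    rw [this.lineDeriv_eq]
    simp [lineDeriv]
  have h1 : IntegrableOn (fun y => lineDeriv ℝ h y e * W y) (tsupport h) μ :=
    (hh.locallyIntegrable_lineDeriv e).integrableOn_isCompact hs |>.mul_continuousOn
      hW.continuousOn hs
  refine (integrableOn_iff_integrable_of_support_subset ?_).1 h1
  intro y hy
  by_contra hn
  exact hy (by simp [hsup y hn])

/-- A Lipschitz compactly supported function has vanishing mean derivative along a vector field
`∑ b, W b • e b` whose coefficients `W b` are invariant in the direction `e b`. The derivative is
taken along arbitrary curves tangent to the field. -/
theorem integral_derivative_eq_zero {B : Type*} [Fintype B] {e : B → E} {W : B → E → ℝ}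
    {h D : E → ℝ} {C : NNReal} (hh : LipschitzWith C h) (hs : HasCompactSupport h)
    (hW : ∀ b, ∃ K, LipschitzWith K (W b))
    (hinv : ∀ b (y : E) (t : ℝ), W b (y + t • e b) = W b y)
    (hD : ∀ y, ∃ Y : ℝ → E, Y 0 = y ∧ HasDerivAt Y (∑ b, W b y • e b) 0 ∧
      HasDerivAt (fun t => h (Y t)) (D y) 0) :
    ∫ y, D y ∂μ = 0 := by
  -- By Rademacher's theorem `h` is differentiable almost everywhere, and there the chain rule along
  -- the tangent curve identifies `D y`.
  have h1 : ∀ᵐ y ∂μ, D y = ∑ b, lineDeriv ℝ h y (e b) * W b y := by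
    filter_upwards [hh.ae_differentiableAt (μ := μ)] with y hy
    obtain ⟨Y, hY0, hY, hhY⟩ := hD y
    have hy' : HasFDerivAt h (fderiv ℝ h y) (Y 0) := by
      rw [hY0]
      exact hy.hasFDerivAt
    rw [hhY.unique (hy'.comp_hasDerivAt 0 hY), map_sum]
    refine Finset.sum_congr rfl fun b _ => ?_
    rw [map_smul, hy.lineDeriv_eq_fderiv, smul_eq_mul, mul_comm]
  rw [integral_congr_ae h1, integral_finsetSum _ fun b _ => ?_]
  · refine Finset.sum_eq_zero fun b _ => ?_
    obtain ⟨K, hK⟩ := hW b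
    exact integral_lineDeriv_mul_eq_zero hh hs hK (hinv b)
  · obtain ⟨K, hK⟩ := hW b
    exact integrable_lineDeriv_mul hh hs hK.continuous

end DivergenceFree

/-! ### Supports, invariant faces and continuous dependence for the replicator flow. -/

section ReplicatorDynamics

set_option linter.unusedSectionVars false

variable {ι : Type*} [Fintype ι] [DecidableEq ι]
  {S : ι → Type*} [∀ i, Fintype (S i)] [∀ i, DecidableEq (S i)]

theorem continuous_coord (i : ι) (s : S i) : Continuous fun x : strategySpace S => x.1 i s :=
  (continuous_apply s).comp ((continuous_apply i).comp continuous_subtype_val)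

instance compactSpace_strategySpace : CompactSpace (strategySpace S) := by
  refine isCompact_iff_compactSpace.1 ?_
  have : strategySpace S = Set.pi univ fun i => stdSimplex ℝ (S i) := by
    ext x
    simp [strategySpace]
  rw [this]
  exact isCompact_univ_pi fun i => isCompact_stdSimplex ℝ (S i)

theorem continuous_deviationUtility (u : (∀ i, S i) → ι → ℝ) (p : ι) (s : S p) :
    Continuous (deviationUtility u p s) := by
  unfold deviationUtility expectedUtility
  refine continuous_finsetSum _ fun q _ => continuous_const.mul
    (continuous_finsetProd _ fun i _ => ?_)
  by_cases h : i = p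
  · subst h
    simpa using continuous_const
  · simp only [Function.update_of_ne h]
    fun_prop

theorem contDiff_deviationUtility (u : (∀ i, S i) → ι → ℝ) (p : ι) (s : S p) :
    ContDiff ℝ 1 (deviationUtility u p s) := by
  unfold deviationUtility expectedUtility
  refine ContDiff.sum fun q _ => contDiff_const.mul (contDiff_prod fun i _ => ?_)
  by_cases h : i = p
  · subst h
    simpa using contDiff_const
  · simp only [Function.update_of_ne h]
    exact contDiff_pi.1 (contDiff_pi.1 contDiff_id i) (q i)

/-- A continuously differentiable function agrees on the strategy space with a globally Lipschitz
function. -/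
theorem exists_lipschitzWith_eq_on_strategySpace {F : Type*} [NormedAddCommGroup F]
    [NormedSpace ℝ F] {f : (∀ i, S i → ℝ) → F} (hf : ContDiff ℝ 1 f) :
    ∃ (K : NNReal) (g : (∀ i, S i → ℝ) → F), LipschitzWith K g ∧
      ∀ x ∈ strategySpace S, g x = f x := by
  let χ : ContDiffBump (0 : ∀ i, S i → ℝ) := ⟨1, 2, one_pos, one_lt_two⟩
  obtain ⟨K, hK⟩ := ContDiff.lipschitzWith_of_hasCompactSupport
    (f := fun x => χ x • f x) χ.hasCompactSupport.smul_right
    (χ.contDiff.smul hf) one_ne_zero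
  refine ⟨K, _, hK, fun x hx => ?_⟩
  have : χ x = 1 := χ.one_of_mem_closedBall
    (mem_closedBall_zero_iff.2 (norm_le_one_of_mem_strategySpace hx))
  simp [this]

/-- The support of `x` is contained in the support of `y`. -/
def SupportLE (x y : strategySpace S) : Prop := ∀ i s, y.1 i s = 0 → x.1 i s = 0

theorem SupportLE.trans {x y z : strategySpace S} (h : SupportLE x y) (h' : SupportLE y z) :
    SupportLE x z := fun i s hs => h i s (h' i s hs)

theorem coord_nonneg (x : strategySpace S) (i : ι) (s : S i) : 0 ≤ x.1 i s := (x.2 i).1 s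

theorem exists_coord_pos (x : strategySpace S) (i : ι) : ∃ s, 0 < x.1 i s := by
  by_contra! h
  have h1 := (x.2 i).2
  rw [Finset.sum_eq_zero fun s _ => le_antisymm (h s) (coord_nonneg x i s)] at h1
  exact zero_ne_one h1

variable {u : (∀ i, S i) → ι → ℝ} {φ : Flow ℝ (strategySpace S)}

theorem IsReplicatorFlow.hasDerivAt_coord (hφ : IsReplicatorFlow u φ) (x : strategySpace S)
    (i : ι) (s : S i) (t : ℝ) :
    HasDerivAt (fun τ => (φ τ x).1 i s) (replicatorField u (φ t x) i s) t :=
  hasDerivAt_pi.1 (hasDerivAt_pi.1 (hφ x t) i) s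

theorem continuous_orbit (φ : Flow ℝ (strategySpace S)) (x : strategySpace S) :
    Continuous fun t => φ t x :=
  φ.cont'.comp (continuous_id.prodMk continuous_const)

/-- Along an orbit each coordinate solves a scalar homogeneous linear equation, so it is rescaled by
an exponential. This is why the flow preserves supports. -/
theorem IsReplicatorFlow.exists_coord_eq (hφ : IsReplicatorFlow u φ) (x : strategySpace S)
    (i : ι) (s : S i) (t : ℝ) : ∃ c, 0 < c ∧ (φ t x).1 i s = x.1 i s * c := by
  have hd : ∀ r, Continuous fun t => deviationUtility u i r (φ t x).1 := fun r =>
    (continuous_deviationUtility u i r).comp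
      (continuous_subtype_val.comp (continuous_orbit φ x))
  have hc : ∀ r, Continuous fun t => (φ t x).1 i r := fun r =>
    (continuous_coord i r).comp (continuous_orbit φ x)
  have h := linear_solution (y := fun t => (φ t x).1 i s)
    (a := fun t => deviationUtility u i s (φ t x).1 -
      ∑ r, (φ t x).1 i r * deviationUtility u i r (φ t x).1)
    ((hd s).sub (continuous_finsetSum _ fun r _ => (hc r).mul (hd r)))
    (fun t => by
      convert hφ.hasDerivAt_coord x i s t using 1
      simp only [replicatorField]
      ring) t
  rw [φ.map_zero_apply] at h
  exact ⟨_, Real.exp_pos _, h⟩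

theorem IsReplicatorFlow.coord_eq_zero_iff (hφ : IsReplicatorFlow u φ) (x : strategySpace S)
    (i : ι) (s : S i) (t : ℝ) : (φ t x).1 i s = 0 ↔ x.1 i s = 0 := by
  obtain ⟨c, hc, h⟩ := hφ.exists_coord_eq x i s t
  simp [h, hc.ne']

theorem IsReplicatorFlow.coord_pos_iff (hφ : IsReplicatorFlow u φ) (x : strategySpace S)
    (i : ι) (s : S i) (t : ℝ) : 0 < (φ t x).1 i s ↔ 0 < x.1 i s := by
  obtain ⟨c, hc, h⟩ := hφ.exists_coord_eq x i s t
  rw [h, mul_pos_iff_of_pos_right hc]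

theorem IsReplicatorFlow.supportLE (hφ : IsReplicatorFlow u φ) (x : strategySpace S) (t : ℝ) :
    SupportLE (φ t x) x := fun i s h => (hφ.coord_eq_zero_iff x i s t).2 h

theorem pureProfile_apply (q : ∀ i, S i) (i : ι) :
    (pureProfile q).1 i = Pi.single (q i) 1 := rfl

theorem SupportLE.eq_pureProfile {x : strategySpace S} {q : ∀ i, S i}
    (h : SupportLE x (pureProfile q)) : x = pureProfile q := by
  have h0 : ∀ i s, s ≠ q i → x.1 i s = 0 := fun i s hs =>
    h i s (by simp [pureProfile_apply, hs])
  refine Subtype.ext (funext fun i => funext fun s => ?_)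
  by_cases hs : s = q i
  · subst hs
    have h1 := (x.2 i).2
    rw [Finset.sum_eq_single (q i) (fun s _ hs => h0 i s hs) (by simp)] at h1
    simp [pureProfile_apply, h1]
  · rw [h0 i s hs]
    simp [pureProfile_apply, hs]

theorem IsReplicatorFlow.pureProfile_fixed (hφ : IsReplicatorFlow u φ) (q : ∀ i, S i) (t : ℝ) :
    φ t (pureProfile q) = pureProfile q :=
  (hφ.supportLE _ t).eq_pureProfile

theorem exists_lipschitzWith_replicatorField (u : (∀ i, S i) → ι → ℝ) :
    ∃ (K : NNReal) (G : (∀ i, S i → ℝ) → ∀ i, S i → ℝ), LipschitzWith K G ∧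
      ∀ x ∈ strategySpace S, G x = replicatorField u x :=
  exists_lipschitzWith_eq_on_strategySpace (contDiff_replicatorField u)

theorem IsReplicatorFlow.exists_dist_le (hφ : IsReplicatorFlow u φ) :
    ∃ K : ℝ, 0 ≤ K ∧
      ∀ t x y, dist (φ t x) (φ t y) ≤ dist x y * Real.exp (K * |t|) := by
  obtain ⟨K, G, hG, hGF⟩ := exists_lipschitzWith_replicatorField u
  refine ⟨K, K.2, fun t x y => ?_⟩
  -- Rescaling time to `[0, 1]` lets the forward Grönwall estimate cover negative `t` as well.
  have hder : ∀ x : strategySpace S, ∀ r : ℝ,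
      HasDerivAt (fun r => (φ (t * r) x).1) (t • G (φ (t * r) x).1) r := by
    intro x r
    rw [hGF _ (φ (t * r) x).2]
    have h1 : HasDerivAt (fun r : ℝ => t * r) t r := by
      simpa using (hasDerivAt_id r).const_mul t
    exact (hφ x (t * r)).scomp r h1
  have hlip : LipschitzWith (‖t‖₊ * K) fun z => t • G z := by
    have := (lipschitzWith_smul t (β := ∀ i, S i → ℝ)).comp hG
    exact this
  have := dist_le_of_trajectories_ODE (v := fun _ z => t • G z) (K := ‖t‖₊ * K)
    (f := fun r => (φ (t * r) x).1) (g := fun r => (φ (t * r) y).1) (a := 0) (b := 1)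
    (δ := dist x y) (fun _ => hlip)
    (fun r _ => (hder x r).continuousAt.continuousWithinAt)
    (fun r _ => (hder x r).hasDerivWithinAt)
    (fun r _ => (hder y r).continuousAt.continuousWithinAt)
    (fun r _ => (hder y r).hasDerivWithinAt)
    (by simp [Subtype.dist_eq]) 1 (by simp)
  simpa [Subtype.dist_eq, mul_comm] using this

end ReplicatorDynamics

/-! ### Chain equivalence as an equivalence relation. -/

section ChainLemmas

variable {X : Type*} [MetricSpace X] {φ : Flow ℝ X}

theorem PseudoOrbit.trans {x y z : X} (h : PseudoOrbit φ x y) (h' : PseudoOrbit φ y z) :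
    PseudoOrbit φ x z :=
  fun ε hε T hT => Relation.TransGen.trans (h ε hε T hT) (h' ε hε T hT)

theorem ChainEquiv.symm {x y : X} (h : ChainEquiv φ x y) : ChainEquiv φ y x := ⟨h.2, h.1⟩

theorem ChainEquiv.trans {x y z : X} (h : ChainEquiv φ x y) (h' : ChainEquiv φ y z) :
    ChainEquiv φ x z := ⟨h.1.trans h'.1, h'.2.trans h.2⟩

theorem IsChainComponent.eq_setOf_chainEquiv {C : Set X} (hC : IsChainComponent φ C) {y : X}
    (hy : y ∈ C) : C = {z | ChainEquiv φ y z} := by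
  obtain ⟨x, -, rfl⟩ := hC
  ext z
  exact ⟨fun hz => (ChainEquiv.symm hy).trans hz, fun hz => ChainEquiv.trans hy hz⟩

end ChainLemmas

/-! ### Pseudo-orbits along the arcs of the response graph. -/

section Edges

set_option linter.unusedSectionVars false

variable {ι : Type*} [Fintype ι] [DecidableEq ι]
  {S : ι → Type*} [∀ i, Fintype (S i)] [∀ i, DecidableEq (S i)]

/-- The point dividing the segment between the pure profiles `p` and `Function.update p i s`
in the ratio `l : 1 - l`. -/
def edgePoint (p : ∀ i, S i) (i : ι) (s : S i) (l : Icc (0 : ℝ) 1) : strategySpace S :=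
  ⟨Function.update (pureProfile p).1 i ((1 - l.1) • Pi.single (p i) 1 + l.1 • Pi.single s 1), by
    intro j
    by_cases h : j = i
    · subst h
      rw [Function.update_self]
      exact convex_stdSimplex ℝ (S j) (single_mem_stdSimplex ℝ (p j)) (single_mem_stdSimplex ℝ s)
        (by linarith [l.2.2]) l.2.1 (by ring)
    · rw [Function.update_of_ne h]
      exact (pureProfile p).2 j⟩

theorem edgePoint_self (p : ∀ i, S i) (i : ι) (s : S i) (l : Icc (0 : ℝ) 1) :
    (edgePoint p i s l).1 i = (1 - l.1) • Pi.single (p i) 1 + l.1 • Pi.single s 1 :=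
  Function.update_self ..

theorem edgePoint_of_ne (p : ∀ i, S i) {i j : ι} (s : S i) (l : Icc (0 : ℝ) 1) (h : j ≠ i) :
    (edgePoint p i s l).1 j = Pi.single (p j) 1 :=
  Function.update_of_ne h ..

theorem edgePoint_zero (p : ∀ i, S i) (i : ι) (s : S i) : edgePoint p i s 0 = pureProfile p := by
  refine Subtype.ext (funext fun j => ?_)
  by_cases h : j = i
  · subst h
    simp [edgePoint_self, pureProfile_apply]
  · simp [edgePoint_of_ne p s 0 h, pureProfile_apply]

theorem edgePoint_one (p : ∀ i, S i) (i : ι) (s : S i) :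
    edgePoint p i s 1 = pureProfile (Function.update p i s) := by
  refine Subtype.ext (funext fun j => ?_)
  by_cases h : j = i
  · subst h
    simp [edgePoint_self, pureProfile_apply]
  · simp [edgePoint_of_ne p s 1 h, pureProfile_apply, h]

theorem dist_edgePoint_le (p : ∀ i, S i) (i : ι) (s : S i) (l m : Icc (0 : ℝ) 1) :
    dist (edgePoint p i s l) (edgePoint p i s m) ≤ |l.1 - m.1| := by
  rw [Subtype.dist_eq, dist_pi_le_iff (abs_nonneg _)]
  intro j
  rw [dist_pi_le_iff (abs_nonneg _)]
  intro r
  by_cases h : j = i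
  · subst h
    rw [edgePoint_self, edgePoint_self, Real.dist_eq]
    have h1 : |(if r = s then (1 : ℝ) else 0) - (if r = p j then 1 else 0)| ≤ 1 := by
      split_ifs <;> norm_num
    calc _ = |(l.1 - m.1) * ((if r = s then (1 : ℝ) else 0) - (if r = p j then 1 else 0))| := by
            simp only [Pi.add_apply, Pi.smul_apply, smul_eq_mul, Pi.single_apply]
            ring_nf
      _ ≤ |l.1 - m.1| := by
            rw [abs_mul]
            exact mul_le_of_le_one_right (abs_nonneg _) h1
  · rw [edgePoint_of_ne p s l h, edgePoint_of_ne p s m h]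
    simp

/-- An edge is a face, hence cut out by a support condition; since supports are preserved, orbits
stay on it. -/
theorem SupportLE.exists_eq_edgePoint {p : ∀ i, S i} {i : ι} {s : S i} (hs : s ≠ p i)
    {l : Icc (0 : ℝ) 1} {x : strategySpace S} (h : SupportLE x (edgePoint p i s l)) :
    ∃ m : Icc (0 : ℝ) 1, x = edgePoint p i s m ∧ m.1 = x.1 i s := by
  have hi : ∀ r, r ≠ p i → r ≠ s → x.1 i r = 0 := fun r h1 h2 =>
    h i r (by simp [edgePoint_self, h1, h2])
  have hsum : x.1 i s + x.1 i (p i) = 1 := by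
    rw [← (x.2 i).2, Finset.sum_eq_add s (p i) hs (fun r _ hr => hi r hr.2 hr.1) (by simp)
      (by simp)]
  have h0 := coord_nonneg x i s
  have h1 := coord_nonneg x i (p i)
  refine ⟨⟨x.1 i s, h0, by linarith⟩, Subtype.ext (funext fun j => funext fun r => ?_), rfl⟩
  by_cases hj : j = i
  · subst hj
    simp only [edgePoint_self, Pi.add_apply, Pi.smul_apply, smul_eq_mul, Pi.single_apply]
    by_cases h2 : r = p j
    · subst h2
      simp [Ne.symm hs]
      linarith
    · by_cases h3 : r = s
      · subst h3
        simp [h2]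
      · simp [h2, h3, hi r h2 h3]
  · rw [edgePoint_of_ne _ _ _ hj]
    have hz : ∀ r, r ≠ p j → x.1 j r = 0 := fun r hr =>
      h j r (by simp [edgePoint_of_ne _ _ _ hj, hr])
    by_cases hr : r = p j
    · subst hr
      have := (x.2 j).2
      rw [Finset.sum_eq_single (p j) (fun r _ hr => hz r hr) (by simp)] at this
      simp [this]
    · simp [hz r hr, hr]

theorem expectedUtility_pureProfile (u : (∀ i, S i) → ι → ℝ) (i : ι) (q : ∀ i, S i) :
    expectedUtility u i (pureProfile q).1 = u q i := by
  unfold expectedUtility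
  rw [Finset.sum_eq_single q]
  · simp [pureProfile_apply]
  · intro r _ hr
    obtain ⟨j, hj⟩ := Function.ne_iff.1 hr
    rw [Finset.prod_eq_zero (Finset.mem_univ j), mul_zero]
    simp [pureProfile_apply, hj]
  · simp

theorem deviationUtility_edgePoint (u : (∀ i, S i) → ι → ℝ) (p : ∀ i, S i) (i : ι) (s : S i)
    (l : Icc (0 : ℝ) 1) (r : S i) :
    deviationUtility u i r (edgePoint p i s l).1 = u (Function.update p i r) i := by
  rw [← expectedUtility_pureProfile u, deviationUtility]
  congr 1
  funext j
  by_cases h : j = i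
  · subst h
    simp [pureProfile_apply]
  · simp [h, edgePoint_of_ne _ _ _ h, pureProfile_apply]

/-- All other players are pure on the edge, so the payoffs of player `i` are constant there and the
equation becomes logistic. -/
theorem replicatorField_edgePoint (u : (∀ i, S i) → ι → ℝ) (p : ∀ i, S i) (i : ι) (s : S i)
    (hs : s ≠ p i) (l : Icc (0 : ℝ) 1) :
    replicatorField u (edgePoint p i s l).1 i s =
      l.1 * (1 - l.1) * (u (Function.update p i s) i - u p i) := by
  simp only [replicatorField, deviationUtility_edgePoint, edgePoint_self, Pi.add_apply,
    Pi.smul_apply, smul_eq_mul, add_mul, Finset.sum_add_distrib, Pi.single_apply]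
  simp [hs]
  ring

variable {u : (∀ i, S i) → ι → ℝ} {φ : Flow ℝ (strategySpace S)}

theorem IsReplicatorFlow.exists_edgePoint (hφ : IsReplicatorFlow u φ) {p : ∀ i, S i} {i : ι}
    {s : S i} (hs : s ≠ p i) (hu : u p i ≤ u (Function.update p i s) i) (l : Icc (0 : ℝ) 1)
    {t : ℝ} (ht : 0 ≤ t) :
    ∃ m : Icc (0 : ℝ) 1, l ≤ m ∧ φ t (edgePoint p i s l) = edgePoint p i s m := by
  have hmono : Monotone fun t => (φ t (edgePoint p i s l)).1 i s := by
    refine monotone_of_deriv_nonneg (fun t => (hφ.hasDerivAt_coord _ i s t).differentiableAt)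
      fun t => ?_
    rw [(hφ.hasDerivAt_coord _ i s t).deriv]
    obtain ⟨m, hm, -⟩ := SupportLE.exists_eq_edgePoint hs (hφ.supportLE (edgePoint p i s l) t)
    rw [hm, replicatorField_edgePoint u p i s hs]
    exact mul_nonneg (mul_nonneg m.2.1 (by linarith [m.2.2])) (by linarith)
  obtain ⟨m, hm, hm'⟩ := SupportLE.exists_eq_edgePoint hs (hφ.supportLE (edgePoint p i s l) t)
  refine ⟨m, ?_, hm⟩
  have h1 := hmono ht
  simp only [φ.map_zero_apply] at h1
  rw [← hm'] at h1
  refine Subtype.coe_le_coe.1 (le_trans (le_of_eq ?_) h1)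
  simp [edgePoint_self, hs]

theorem IsReplicatorFlow.pseudoOrbit_pureProfile_self (hφ : IsReplicatorFlow u φ)
    (p : ∀ i, S i) : PseudoOrbit φ (pureProfile p) (pureProfile p) := by
  intro ε hε T _
  exact Relation.TransGen.single ⟨T, le_rfl, by rwa [hφ.pureProfile_fixed, dist_self]⟩

/-- The flow never moves back towards `p`, so jumps of size at most `ε / 2` accumulate and reach the
far end in finitely many steps. Ties, where the whole edge is at rest, need no separate treatment.
-/
theorem IsReplicatorFlow.pseudoOrbit_of_le (hφ : IsReplicatorFlow u φ) {p : ∀ i, S i} {i : ι}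
    {s : S i} (hs : s ≠ p i) (hu : u p i ≤ u (Function.update p i s) i) :
    PseudoOrbit φ (pureProfile p) (pureProfile (Function.update p i s)) := by
  intro ε hε T hT
  have key : ∀ n : ℕ, ∃ l : Icc (0 : ℝ) 1, min 1 (n * (ε / 2)) ≤ l.1 ∧
      HasChain φ ε T (pureProfile p) (edgePoint p i s l) := by
    intro n
    induction n with
    | zero =>
      refine ⟨0, by simp, ?_⟩
      rw [edgePoint_zero]
      exact hφ.pseudoOrbit_pureProfile_self p ε hε T hT
    | succ n ih =>
      obtain ⟨l, hl, hc⟩ := ih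
      obtain ⟨m, hlm, hm⟩ := hφ.exists_edgePoint hs hu l hT.le
      have hm1 := m.2.2
      have hm0 := m.2.1
      have hlm' : l.1 ≤ m.1 := hlm
      refine ⟨⟨min 1 (m.1 + ε / 2), by positivity, min_le_left _ _⟩, ?_,
        Relation.TransGen.tail hc ⟨T, le_rfl, ?_⟩⟩
      · push_cast
        refine le_min (min_le_left _ _) ?_
        rcases min_le_iff.1 hl with h | h
        · exact (min_le_left _ _).trans (by linarith)
        · exact (min_le_right _ _).trans (by linarith)
      · rw [hm]
        refine (dist_edgePoint_le p i s _ _).trans_lt ?_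
        rw [abs_lt]
        have h1 : m.1 ≤ min 1 (m.1 + ε / 2) := le_min hm1 (by linarith)
        have h2 : min 1 (m.1 + ε / 2) ≤ m.1 + ε / 2 := min_le_right _ _
        constructor <;> simp only <;> linarith
  obtain ⟨n, hn⟩ := exists_nat_ge (1 / (ε / 2))
  obtain ⟨l, hl, hc⟩ := key n
  have h1 : 1 ≤ n * (ε / 2) := by rwa [div_le_iff₀ (by positivity)] at hn
  rw [min_eq_left h1] at hl
  have : l = 1 := Subtype.ext (le_antisymm l.2.2 hl)
  rwa [this, edgePoint_one] at hc

theorem IsReplicatorFlow.pseudoOrbit_of_reachable (hφ : IsReplicatorFlow u φ) {p q : ∀ i, S i}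
    (h : Reachable (responseGraph u) p q) :
    PseudoOrbit φ (pureProfile p) (pureProfile q) := by
  induction h with
  | refl => exact hφ.pseudoOrbit_pureProfile_self p
  | tail _ hadj ih =>
    rename_i a b _
    obtain ⟨i, ⟨hne, hab⟩, hu⟩ := hadj
    have hb : b = Function.update a i (b i) := by
      funext j
      by_cases hj : j = i
      · subst hj
        simp
      · simp [hj, hab j hj]
    refine ih.trans ?_
    rw [hb] at hu ⊢
    exact hφ.pseudoOrbit_of_le hne.symm hu

end Edges

theorem exists_lipschitzWith_mul {α : Type*} [PseudoMetricSpace α] {f g : α → ℝ} {A B : ℝ}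
    {C D : NNReal} (hf : LipschitzWith C f) (hg : LipschitzWith D g) (hA : ∀ x, |f x| ≤ A)
    (hB : ∀ x, |g x| ≤ B) : ∃ K, LipschitzWith K fun x => f x * g x := by
  refine ⟨(A * D + B * C).toNNReal, LipschitzWith.of_dist_le' fun x y => ?_⟩
  have h1 := hf.dist_le_mul x y
  have h2 := hg.dist_le_mul x y
  rw [Real.dist_eq] at h1 h2 ⊢
  calc |f x * g x - f y * g y| = |f x * (g x - g y) + g y * (f x - f y)| := by ring_nf
    _ ≤ |f x| * |g x - g y| + |g y| * |f x - f y| := by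
        rw [← abs_mul, ← abs_mul]
        exact abs_add_le _ _
    _ ≤ A * (D * dist x y) + B * (C * dist x y) :=
        add_le_add (mul_le_mul (hA x) h2 (abs_nonneg _) ((abs_nonneg _).trans (hA x)))
          (mul_le_mul (hB y) h1 (abs_nonneg _) ((abs_nonneg _).trans (hB y)))
    _ = (A * D + B * C) * dist x y := by ring

/-! ### Logarithmic coordinates on the relative interior of a face. -/

section Softmax

set_option linter.unusedSectionVars false

variable {ι : Type*} [Fintype ι] [DecidableEq ι]
  {S : ι → Type*} [∀ i, Fintype (S i)] [∀ i, DecidableEq (S i)]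

/-- `x` and `y` have the same support. -/
def SameSupport (x y : strategySpace S) : Prop := ∀ i s, 0 < x.1 i s ↔ 0 < y.1 i s

/-- The normalising factor of `softmax`. -/
noncomputable def partition (a : strategySpace S) (y : ∀ i, S i → ℝ) (i : ι) : ℝ :=
  ∑ t, a.1 i t * Real.exp (y i t)

theorem partition_pos (a : strategySpace S) (y : ∀ i, S i → ℝ) (i : ι) : 0 < partition a y i := by
  obtain ⟨s, hs⟩ := exists_coord_pos a i
  exact Finset.sum_pos' (fun t _ => mul_nonneg (coord_nonneg a i t) (Real.exp_pos _).le)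
    ⟨s, Finset.mem_univ s, mul_pos hs (Real.exp_pos _)⟩

/-- The softmax parametrisation, with weights `a`, of the mixed profiles with the support
of `a`. -/
noncomputable def softmax (a : strategySpace S) (y : ∀ i, S i → ℝ) : strategySpace S :=
  ⟨fun i s => a.1 i s * Real.exp (y i s) / partition a y i, fun i =>
    ⟨fun s => div_nonneg (mul_nonneg (coord_nonneg a i s) (Real.exp_pos _).le)
      (partition_pos a y i).le, by
      rw [← Finset.sum_div]
      exact div_self (partition_pos a y i).ne'⟩⟩

theorem softmax_apply (a : strategySpace S) (y : ∀ i, S i → ℝ) (i : ι) (s : S i) :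
    (softmax a y).1 i s = a.1 i s * Real.exp (y i s) / partition a y i := rfl

theorem sameSupport_softmax (a : strategySpace S) (y : ∀ i, S i → ℝ) :
    SameSupport (softmax a y) a := by
  intro i s
  rw [softmax_apply, div_pos_iff_of_pos_right (partition_pos a y i),
    mul_pos_iff_of_pos_right (Real.exp_pos _)]

theorem softmax_congr (a : strategySpace S) {y z : ∀ i, S i → ℝ} {i : ι} (h : y i = z i) :
    (softmax a y).1 i = (softmax a z).1 i := by
  funext s
  simp only [softmax_apply, partition, h]

/-- A change of `y` by at most `d` alters numerator and normalising factor by factors at most `exp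
d`, hence the quotient by at most `exp (2 * d)`. The bound `1 - 2 * d ≤ exp (-(2 * d))` makes this
additive, as the coordinates are at most `1`. -/
theorem softmax_sub_le (a : strategySpace S) (y z : ∀ i, S i → ℝ) (i : ι) (s : S i) :
    (softmax a y).1 i s - (softmax a z).1 i s ≤ 2 * dist y z := by
  set d := dist y z with hd
  have hyz : ∀ t, |y i t - z i t| ≤ d := fun t =>
    (dist_le_pi_dist (y i) (z i) t).trans (dist_le_pi_dist y z i)
  have hZ : partition a z i ≤ Real.exp d * partition a y i := by
    rw [partition, partition, Finset.mul_sum]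
    refine Finset.sum_le_sum fun t _ => ?_
    rw [mul_left_comm, ← Real.exp_add]
    exact mul_le_mul_of_nonneg_left
      (Real.exp_le_exp.2 (by linarith [(abs_le.1 (hyz t)).1])) (coord_nonneg a i t)
  have hn : a.1 i s * Real.exp (y i s) ≤ Real.exp d * (a.1 i s * Real.exp (z i s)) := by
    rw [mul_left_comm, ← Real.exp_add]
    exact mul_le_mul_of_nonneg_left
      (Real.exp_le_exp.2 (by linarith [(abs_le.1 (hyz s)).2])) (coord_nonneg a i s)
  have h1 : (softmax a y).1 i s ≤ Real.exp (2 * d) * (softmax a z).1 i s := by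
    rw [softmax_apply, softmax_apply, div_le_iff₀ (partition_pos a y i), mul_assoc,
      div_mul_eq_mul_div, ← mul_div_assoc, le_div_iff₀ (partition_pos a z i)]
    calc a.1 i s * Real.exp (y i s) * partition a z i
        ≤ (Real.exp d * (a.1 i s * Real.exp (z i s))) * (Real.exp d * partition a y i) := by
          refine mul_le_mul hn hZ (partition_pos a z i).le ?_
          exact mul_nonneg (Real.exp_pos _).le (mul_nonneg (coord_nonneg a i s) (Real.exp_pos _).le)
      _ = _ := by
          rw [two_mul, Real.exp_add]
          ring
  have h2 : 1 - 2 * d ≤ Real.exp (-(2 * d)) := by linarith [Real.add_one_le_exp (-(2 * d))]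
  have h3 : Real.exp (-(2 * d)) * (softmax a y).1 i s ≤ (softmax a z).1 i s := by
    rw [Real.exp_neg, inv_mul_le_iff₀ (Real.exp_pos _)]
    exact h1
  have h4 : (softmax a y).1 i s ≤ 1 := by
    have := norm_le_one_of_mem_strategySpace (softmax a y).2
    exact (le_abs_self _).trans ((norm_le_pi_norm _ s).trans ((norm_le_pi_norm _ i).trans this))
  have h5 := mul_le_mul_of_nonneg_right h2 (coord_nonneg (softmax a y) i s)
  have h6 : 0 ≤ d := dist_nonneg
  nlinarith

theorem lipschitzWith_softmax (a : strategySpace S) : LipschitzWith 2 (softmax a) := by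
  refine LipschitzWith.of_dist_le_mul fun y z => ?_
  rw [Subtype.dist_eq]
  have h0 : 0 ≤ ((2 : NNReal) : ℝ) * dist y z := by positivity
  rw [dist_pi_le_iff h0]
  intro i
  rw [dist_pi_le_iff h0]
  intro s
  rw [Real.dist_eq, abs_sub_le_iff]
  have h1 := softmax_sub_le a z y i s
  rw [dist_comm] at h1
  exact ⟨softmax_sub_le a y z i s, h1⟩

variable (a : strategySpace S) (o : ∀ i, S i)

/-- Kills the coordinates in the support of `a` other than the reference coordinates `o`. -/
noncomputable def anchor (y : ∀ i, S i → ℝ) : ∀ i, S i → ℝ :=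
  open scoped Classical in fun i s => if 0 < a.1 i s ∧ s ≠ o i then 0 else y i s

theorem lipschitzWith_anchor : LipschitzWith 1 (anchor a o) := by
  refine LipschitzWith.of_dist_le_mul fun y z => ?_
  rw [NNReal.coe_one, one_mul, dist_pi_le_iff dist_nonneg]
  intro i
  rw [dist_pi_le_iff dist_nonneg]
  intro s
  unfold anchor
  split_ifs
  · simp
  · exact (dist_le_pi_dist (y i) (z i) s).trans (dist_le_pi_dist y z i)

/-- The logarithmic coordinates of `x`, with the free parameters taken from `w`. -/
noncomputable def logCoord (x : strategySpace S) (w : ∀ i, S i → ℝ) : ∀ i, S i → ℝ :=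
  open scoped Classical in fun i s => if 0 < a.1 i s then
    w i (o i) + (Real.log (x.1 i s) - Real.log (a.1 i s)) -
      (Real.log (x.1 i (o i)) - Real.log (a.1 i (o i))) else w i s

variable {a o}

theorem logCoord_anchor (x : strategySpace S) (w : ∀ i, S i → ℝ) :
    logCoord a o x (anchor a o w) = logCoord a o x w := by
  funext i s
  unfold logCoord anchor
  by_cases h : 0 < a.1 i s <;> simp [h]

theorem anchor_logCoord (x : strategySpace S) (w : ∀ i, S i → ℝ) :
    anchor a o (logCoord a o x w) = anchor a o w := by
  funext i s
  unfold logCoord anchor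
  by_cases h : 0 < a.1 i s
  · by_cases h' : s = o i
    · subst h'
      simp [h]
    · simp [h, h']
  · simp [h]

/-- For each player the weights `a * exp` are proportional to `x`, with a factor independent of the
strategy; normalising removes it. -/
theorem softmax_logCoord {x : strategySpace S} (hx : SameSupport x a)
    (w : ∀ i, S i → ℝ) : softmax a (logCoord a o x w) = x := by
  have key : ∀ i s, a.1 i s * Real.exp (logCoord a o x w i s) =
      x.1 i s * Real.exp (w i (o i) - (Real.log (x.1 i (o i)) - Real.log (a.1 i (o i)))) := by
    intro i s
    by_cases h : 0 < a.1 i s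
    · have hx' := (hx i s).2 h
      simp only [logCoord, h, if_true]
      rw [add_sub_right_comm, Real.exp_add, Real.exp_sub (Real.log (x.1 i s)), Real.exp_log hx',
        Real.exp_log h]
      field_simp
    · have h1 : a.1 i s = 0 := le_antisymm (not_lt.1 h) (coord_nonneg a i s)
      have h2 : x.1 i s = 0 :=
        le_antisymm (not_lt.1 fun h' => h ((hx i s).1 h')) (coord_nonneg x i s)
      rw [h1, h2, zero_mul, zero_mul]
  refine Subtype.ext (funext fun i => funext fun s => ?_)
  rw [softmax_apply, partition]
  simp only [key]
  rw [← Finset.sum_mul, (x.2 i).2, one_mul, mul_div_assoc, div_self (Real.exp_pos _).ne', mul_one]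

/-- Taking the difference with the reference coordinate cancels the logarithm of the partition sum,
and the forgotten constants are read off `y` itself. -/
theorem logCoord_softmax (ho : ∀ i, 0 < a.1 i (o i)) (y : ∀ i, S i → ℝ) :
    logCoord a o (softmax a y) y = y := by
  have hlog : ∀ i s, 0 < a.1 i s →
      Real.log ((softmax a y).1 i s) - Real.log (a.1 i s) =
        y i s - Real.log (partition a y i) := by
    intro i s h
    rw [softmax_apply, Real.log_div (mul_pos h (Real.exp_pos _)).ne' (partition_pos a y i).ne',
      Real.log_mul h.ne' (Real.exp_pos _).ne', Real.log_exp]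
    ring
  funext i s
  unfold logCoord
  split_ifs with h
  · rw [hlog i s h, hlog i (o i) (ho i)]
    ring
  · rfl

variable (a o) in
/-- The cutoff in the free parameters. -/
noncomputable def cutoff (y : ∀ i, S i → ℝ) : ℝ := max 0 (1 - ‖anchor a o y‖)

theorem cutoff_nonneg (y : ∀ i, S i → ℝ) : 0 ≤ cutoff a o y := le_max_left _ _

theorem abs_cutoff_le (y : ∀ i, S i → ℝ) : |cutoff a o y| ≤ 1 := by
  rw [abs_of_nonneg (cutoff_nonneg y)]
  exact max_le zero_le_one (by linarith [norm_nonneg (anchor a o y)])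

theorem cutoff_logCoord (x : strategySpace S) (w : ∀ i, S i → ℝ) :
    cutoff a o (logCoord a o x w) = cutoff a o w := by
  rw [cutoff, cutoff, anchor_logCoord]

theorem lipschitzWith_cutoff : LipschitzWith 1 (cutoff a o) := by
  have h1 : LipschitzWith 1 fun y => ‖anchor a o y‖ := by
    have := lipschitzWith_one_norm.comp (lipschitzWith_anchor a o)
    rwa [one_mul] at this
  have h2 : LipschitzWith 1 fun y => 1 - ‖anchor a o y‖ := by
    simpa using (LipschitzWith.const (1 : ℝ)).sub h1
  exact h2.const_max 0

/-- `f` confines the mixed profile to `K` and the cutoff confines the free parameters to the unit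
ball. `logCoord` is continuous on the product, since the coordinates whose logarithm is taken stay
positive on `K`. -/
theorem hasCompactSupport_softmax_mul_cutoff (ho : ∀ i, 0 < a.1 i (o i))
    {K : Set (strategySpace S)} (hK : IsCompact K) (hKa : ∀ x ∈ K, SameSupport x a)
    {f : strategySpace S → ℝ} (hf : ∀ x, SameSupport x a → x ∉ K → f x = 0) :
    HasCompactSupport fun y => f (softmax a y) * cutoff a o y := by
  have hc : ContinuousOn (fun z : strategySpace S × (∀ i, S i → ℝ) => logCoord a o z.1 z.2)
      (K ×ˢ Metric.closedBall 0 1) := by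
    rw [continuousOn_pi]
    intro i
    rw [continuousOn_pi]
    intro s
    have hlog : ∀ r, 0 < a.1 i r →
        ContinuousOn (fun z : strategySpace S × (∀ i, S i → ℝ) => Real.log (z.1.1 i r))
          (K ×ˢ Metric.closedBall 0 1) := by
      intro r hr
      refine ContinuousOn.log ((continuous_coord i r).comp continuous_fst).continuousOn ?_
      intro z hz
      exact ((hKa z.1 hz.1 i r).2 hr).ne'
    by_cases h : 0 < a.1 i s
    · simp only [logCoord, h, if_true]
      refine ContinuousOn.sub (ContinuousOn.add ?_ ((hlog s h).sub continuousOn_const))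
        ((hlog _ (ho i)).sub continuousOn_const)
      fun_prop
    · simp only [logCoord, h, if_false]
      fun_prop
  refine HasCompactSupport.intro
    ((hK.prod (isCompact_closedBall (0 : ∀ i, S i → ℝ) 1)).image_of_continuousOn hc) ?_
  intro y hy
  by_contra hne
  refine hy ⟨(softmax a y, anchor a o y), ⟨?_, ?_⟩, ?_⟩
  · by_contra hn
    exact hne (by rw [hf _ (sameSupport_softmax a y) hn, zero_mul])
  · by_contra hn
    simp only [Metric.mem_closedBall, dist_zero_right, not_le] at hn
    exact hne (by rw [cutoff, max_eq_left (by linarith), mul_zero])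
  · simp only [logCoord_anchor, logCoord_softmax ho]

end Softmax

/-! ### Volume preservation in logarithmic coordinates. -/

section VolumePreservation

set_option linter.unusedSectionVars false

variable {ι : Type*} [Fintype ι] [DecidableEq ι]
  {S : ι → Type*} [∀ i, Fintype (S i)] [∀ i, DecidableEq (S i)]
  {u : (∀ i, S i) → ι → ℝ} {φ : Flow ℝ (strategySpace S)}
  {a : strategySpace S} {o : ∀ i, S i}

variable (u a o) in
/-- The replicator vector field in logarithmic coordinates. -/
noncomputable def logField (i : ι) (s : S i) (y : ∀ i, S i → ℝ) : ℝ :=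
  open scoped Classical in if 0 < a.1 i s then
    deviationUtility u i s (softmax a y).1 - deviationUtility u i (o i) (softmax a y).1 else 0

theorem exists_lipschitzWith_logField (i : ι) (s : S i) :
    ∃ K, LipschitzWith K (logField u a o i s) := by
  by_cases h : 0 < a.1 i s
  · obtain ⟨K, g, hg, hgx⟩ := exists_lipschitzWith_eq_on_strategySpace
      ((contDiff_deviationUtility u i s).sub (contDiff_deviationUtility u i (o i)))
    refine ⟨K * (1 * 2), ?_⟩
    have h1 := hg.comp ((LipschitzWith.subtype_val (strategySpace S)).comp
      (lipschitzWith_softmax a))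
    convert h1 using 1
    funext y
    simp only [logField, h, if_true, Function.comp_apply]
    rw [hgx _ (softmax a y).2]
  · refine ⟨0, ?_⟩
    have : logField u a o i s = fun _ => 0 := by
      funext y
      simp [logField, h]
    rw [this]
    exact LipschitzWith.const 0

theorem deviationUtility_congr (u : (∀ i, S i) → ι → ℝ) {i : ι} (s : S i)
    {x y : ∀ i, S i → ℝ} (h : ∀ j, j ≠ i → x j = y j) :
    deviationUtility u i s x = deviationUtility u i s y := by
  unfold deviationUtility
  congr 1
  funext j
  by_cases hj : j = i
  · subst hj
    simp
  · simp [hj, h j hj]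

/-- The logarithmic field is divergence free: no component depends on its own coordinate. -/
theorem logField_add_smul (i : ι) (s : S i) (y : ∀ i, S i → ℝ) (t : ℝ) :
    logField u a o i s (y + t • (Pi.single i (Pi.single s 1) : ∀ i, S i → ℝ)) = logField u a o i s y := by
  have h : ∀ j, j ≠ i → (softmax a (y + t • (Pi.single i (Pi.single s 1) : ∀ i, S i → ℝ))).1 j =
      (softmax a y).1 j := fun j hj => softmax_congr a (by simp [hj])
  unfold logField
  rw [deviationUtility_congr u s h, deviationUtility_congr u (o i) h]

theorem sum_smul_single_single (w : ∀ i, S i → ℝ) :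
    ∑ b : Σ i, S i, w b.1 b.2 • (Pi.single b.1 (Pi.single b.2 1) : ∀ i, S i → ℝ) = w := by
  funext i s
  simp only [Fintype.sum_sigma, Finset.sum_apply, Pi.smul_apply, smul_eq_mul]
  rw [Finset.sum_eq_single i (fun j _ hj => Finset.sum_eq_zero fun r _ => by simp [hj.symm])
    (by simp), Finset.sum_eq_single s (fun r _ hr => by simp [hr.symm]) (by simp)]
  simp

/-- The logarithmic derivative of a coordinate is its payoff minus the mean payoff; the mean cancels
against the reference coordinate. -/
theorem IsReplicatorFlow.hasDerivAt_logCoord (hφ : IsReplicatorFlow u φ)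
    (ho : ∀ i, 0 < a.1 i (o i)) (y : ∀ i, S i → ℝ) :
    HasDerivAt (fun t => logCoord a o (φ t (softmax a y)) y)
      (fun i s => logField u a o i s y) 0 := by
  rw [hasDerivAt_pi]
  intro i
  rw [hasDerivAt_pi]
  intro s
  by_cases h : 0 < a.1 i s
  · have hlog : ∀ r, 0 < a.1 i r →
        HasDerivAt (fun t => Real.log ((φ t (softmax a y)).1 i r))
          (deviationUtility u i r (softmax a y).1 -
            ∑ q, (softmax a y).1 i q * deviationUtility u i q (softmax a y).1) 0 := by
      intro r hr
      have hpos : 0 < (softmax a y).1 i r := (sameSupport_softmax a y i r).2 hr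
      have h1 := (hφ.hasDerivAt_coord (softmax a y) i r 0).log
        (by rw [φ.map_zero_apply]; exact hpos.ne')
      refine h1.congr_deriv ?_
      rw [φ.map_zero_apply, replicatorField, mul_div_cancel_left₀ _ hpos.ne']
    simp only [logCoord, logField, h, if_true]
    have h2 := ((((hlog s h).sub_const (Real.log (a.1 i s))).const_add (y i (o i)))).sub
      ((hlog (o i) (ho i)).sub_const (Real.log (a.1 i (o i))))
    refine h2.congr_deriv ?_
    ring
  · simp only [logCoord, logField, h, if_false]
    exact hasDerivAt_const _ _

theorem IsReplicatorFlow.sameSupport (hφ : IsReplicatorFlow u φ) {x : strategySpace S}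
    (hx : SameSupport x a) (t : ℝ) : SameSupport (φ t x) a :=
  fun i s => (hφ.coord_pos_iff x i s t).trans (hx i s)

/-- Moving the starting point along the orbit shifts the window of integration. This exhibits the
increment of `g` over time `τ` as a derivative along the flow. -/
theorem hasDerivAt_integral_orbit {g : strategySpace S → ℝ} (hg : Continuous g)
    (x : strategySpace S) (τ : ℝ) :
    HasDerivAt (fun t => ∫ s in (0 : ℝ)..τ, g (φ s (φ t x))) (g (φ τ x) - g x) 0 := by
  have hc : Continuous fun s => g (φ s x) := hg.comp (continuous_orbit φ x)
  have h1 : ∀ r, HasDerivAt (fun t => ∫ s in (0 : ℝ)..t, g (φ s x)) (g (φ r x)) r := fun r =>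
    intervalIntegral.integral_hasDerivAt_right (hc.intervalIntegrable _ _)
      (hc.stronglyMeasurableAtFilter _ _) hc.continuousAt
  have h2 : (fun t => ∫ s in (0 : ℝ)..τ, g (φ s (φ t x))) =
      fun t => (∫ s in (0 : ℝ)..(τ + t), g (φ s x)) - ∫ s in (0 : ℝ)..t, g (φ s x) := by
    funext t
    simp only [← Flow.map_add]
    rw [intervalIntegral.integral_comp_add_right (fun s => g (φ s x)) t, zero_add,
      intervalIntegral.integral_interval_sub_left (hc.intervalIntegrable _ _)
        (hc.intervalIntegrable _ _)]
  rw [h2]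
  have h3 := h1 (τ + 0)
  refine ((h3.comp_const_add τ 0).sub (h1 0)).congr_deriv ?_
  simp

theorem IsReplicatorFlow.exists_lipschitzWith_integral (hφ : IsReplicatorFlow u φ)
    {g : strategySpace S → ℝ} {C : NNReal} (hg : LipschitzWith C g) (τ : ℝ) :
    ∃ L, LipschitzWith L fun x => ∫ s in (0 : ℝ)..τ, g (φ s x) := by
  obtain ⟨K, hK, hdist⟩ := hφ.exists_dist_le
  refine ⟨(C * Real.exp (K * |τ|) * |τ|).toNNReal, LipschitzWith.of_dist_le' fun x y => ?_⟩
  have hi : ∀ x, IntervalIntegrable (fun s => g (φ s x)) volume 0 τ := fun x =>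
    (hg.continuous.comp (continuous_orbit φ x)).intervalIntegrable _ _
  rw [Real.dist_eq, ← intervalIntegral.integral_sub (hi x) (hi y), ← Real.norm_eq_abs]
  refine (intervalIntegral.norm_integral_le_of_norm_le_const
    (C := C * (dist x y * Real.exp (K * |τ|))) fun s hs => ?_).trans (le_of_eq ?_)
  · rw [← dist_eq_norm]
    refine (hg.dist_le_mul _ _).trans (mul_le_mul_of_nonneg_left ?_ C.2)
    refine (hdist s x y).trans (mul_le_mul_of_nonneg_left ?_ dist_nonneg)
    refine Real.exp_le_exp.2 (mul_le_mul_of_nonneg_left ?_ hK)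
    rcases mem_uIoc.1 hs with h | h
    · rw [abs_of_pos h.1, abs_of_pos (h.1.trans_le h.2)]
      exact h.2
    · rw [abs_of_nonpos h.2, abs_of_neg (h.1.trans_le h.2)]
      linarith [h.1]
  · rw [sub_zero]
    ring

/-- The set of points that reach `K` within the times between `0` and `τ` is compact. -/
theorem isCompact_flow_preimage (φ : Flow ℝ (strategySpace S)) {K : Set (strategySpace S)}
    (hK : IsCompact K) (τ : ℝ) :
    IsCompact {x | ∃ s ∈ uIcc 0 τ, φ s x ∈ K} := by
  have h1 : Continuous fun z : ℝ × strategySpace S => φ (-z.1) z.2 :=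
    φ.cont'.comp ((continuous_neg.comp continuous_fst).prodMk continuous_snd)
  have h2 := ((isCompact_uIcc (a := (0 : ℝ)) (b := τ)).prod hK).image h1
  convert h2 using 1
  ext x
  constructor
  · rintro ⟨s, hs, hx⟩
    exact ⟨(s, φ s x), ⟨hs, hx⟩, by simp [← Flow.map_add]⟩
  · rintro ⟨⟨s, x⟩, ⟨hs, hx⟩, rfl⟩
    exact ⟨s, hs, by simpa [← Flow.map_add] using hx⟩

theorem IsReplicatorFlow.hasCompactSupport_increment (hφ : IsReplicatorFlow u φ)
    (ho : ∀ i, 0 < a.1 i (o i)) {g : strategySpace S → ℝ}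
    {K : Set (strategySpace S)} (hK : IsCompact K) (hKa : ∀ x ∈ K, SameSupport x a)
    (hgK : ∀ x, SameSupport x a → x ∉ K → g x = 0) (τ : ℝ) :
    HasCompactSupport fun y =>
      (g (φ τ (softmax a y)) - g (softmax a y)) * cutoff a o y := by
  refine hasCompactSupport_softmax_mul_cutoff (f := fun x => g (φ τ x) - g x) ho
    (isCompact_flow_preimage φ hK τ) ?_ ?_
  · rintro x ⟨s, -, hx⟩ i r
    rw [← hφ.coord_pos_iff x i r s]
    exact hKa _ hx i r
  · intro x hx hn
    rw [hgK (φ τ x) (hφ.sameSupport hx τ) fun h => hn ⟨τ, right_mem_uIcc, h⟩,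
      hgK x hx fun h => hn ⟨0, left_mem_uIcc, by simpa using h⟩, sub_zero]

/-- The replicator flow preserves volume in logarithmic coordinates, tested against a Lipschitz
function whose support is compact in the relative interior of a face. -/
theorem IsReplicatorFlow.integral_increment_eq_zero (hφ : IsReplicatorFlow u φ)
    (ho : ∀ i, 0 < a.1 i (o i)) {g : strategySpace S → ℝ} {C : NNReal} (hg : LipschitzWith C g)
    {K : Set (strategySpace S)} (hK : IsCompact K) (hKa : ∀ x ∈ K, SameSupport x a)
    (hgK : ∀ x, SameSupport x a → x ∉ K → g x = 0) (τ : ℝ) :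
    ∫ y, (g (φ τ (softmax a y)) - g (softmax a y)) * cutoff a o y = 0 := by
  -- The derivative of this time average (unnormalised) along the flow is `g ∘ φ τ - g`, so the
  -- divergence identity applies to it and no change of variables is needed.
  set f : strategySpace S → ℝ := fun x => ∫ s in (0 : ℝ)..τ, g (φ s x) with hf
  obtain ⟨L, hL⟩ := hφ.exists_lipschitzWith_integral hg τ
  obtain ⟨A, hA⟩ := isCompact_univ.exists_bound_of_continuousOn hL.continuous.continuousOn
  obtain ⟨M, hM⟩ := exists_lipschitzWith_mul (hL.comp (lipschitzWith_softmax a))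
    (lipschitzWith_cutoff (a := a) (o := o)) (fun y => hA (softmax a y) (mem_univ _))
    abs_cutoff_le
  have hs : HasCompactSupport fun y => f (softmax a y) * cutoff a o y := by
    refine hasCompactSupport_softmax_mul_cutoff ho (isCompact_flow_preimage φ hK τ) ?_ ?_
    · rintro x ⟨s, -, hx⟩ i r
      rw [← hφ.coord_pos_iff x i r s]
      exact hKa _ hx i r
    · intro x hx hn
      rw [hf]
      have : ∫ s in (0 : ℝ)..τ, g (φ s x) = ∫ s in (0 : ℝ)..τ, (0 : ℝ) :=
        intervalIntegral.integral_congr fun s hs =>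
          hgK (φ s x) (hφ.sameSupport hx s) fun h => hn ⟨s, hs, h⟩
      simpa using this
  refine integral_derivative_eq_zero (B := Σ i, S i)
    (e := fun b => Pi.single b.1 (Pi.single b.2 1))
    (W := fun b => logField u a o b.1 b.2)
    (h := fun y => f (softmax a y) * cutoff a o y) hM hs
    (fun b => exists_lipschitzWith_logField b.1 b.2)
    (fun b y t => logField_add_smul b.1 b.2 y t) fun y => ?_
  -- The lifted orbit keeps the free parameters of `y`, so the cutoff is constant along it.
  refine ⟨fun t => logCoord a o (φ t (softmax a y)) y, ?_, ?_, ?_⟩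
  · simp only [φ.map_zero_apply, logCoord_softmax ho]
  · rw [sum_smul_single_single fun i s => logField u a o i s y]
    exact hφ.hasDerivAt_logCoord ho y
  · simp only [cutoff_logCoord]
    have h1 : ∀ t, softmax a (logCoord a o (φ t (softmax a y)) y) = φ t (softmax a y) := fun t =>
      softmax_logCoord (hφ.sameSupport (sameSupport_softmax a y) t) y
    simp only [h1]
    exact (hasDerivAt_integral_orbit hg.continuous (softmax a y) τ).mul_const _

/-- A Lipschitz function that is supported in a compact part of the relative interior of a face
and does not decrease along the time-`τ` map is invariant under that map. -/
theorem IsReplicatorFlow.eq_of_le (hφ : IsReplicatorFlow u φ)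
    {g : strategySpace S → ℝ} {C : NNReal} (hg : LipschitzWith C g)
    {K : Set (strategySpace S)} (hK : IsCompact K) (hKa : ∀ x ∈ K, SameSupport x a)
    (hgK : ∀ x, SameSupport x a → x ∉ K → g x = 0) {τ : ℝ}
    (hle : ∀ x, SameSupport x a → g x ≤ g (φ τ x)) {x : strategySpace S}
    (hx : SameSupport x a) : g (φ τ x) = g x := by
  choose o ho using fun i => exists_coord_pos a i
  by_contra hne
  have hφc : Continuous fun x => φ τ x := φ.cont'.comp (continuous_const.prodMk continuous_id)
  have hσ := (lipschitzWith_softmax a).continuous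
  have hc : Continuous fun y => (g (φ τ (softmax a y)) - g (softmax a y)) * cutoff a o y :=
    ((hg.continuous.comp (hφc.comp hσ)).sub (hg.continuous.comp hσ)).mul
      lipschitzWith_cutoff.continuous
  -- The integrand is continuous and nonnegative. If `g` changed at `x`, it would be nonzero at the
  -- logarithmic coordinates of `x` with zero parameters, where the cutoff is `1`, and the integral
  -- would be positive.
  refine (hc.integral_pos_of_hasCompactSupport_nonneg_nonzero (μ := volume)
    (x := logCoord a o x 0) (hφ.hasCompactSupport_increment ho hK hKa hgK τ) (fun y => ?_)
    ?_).ne' (hφ.integral_increment_eq_zero ho hg hK hKa hgK τ)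
  · exact mul_nonneg (sub_nonneg.2 (hle _ (sameSupport_softmax a y))) (cutoff_nonneg y)
  · rw [cutoff_logCoord, softmax_logCoord hx]
    refine mul_ne_zero (sub_ne_zero.2 hne) ?_
    have : anchor a o 0 = 0 := by
      funext i s
      simp [anchor]
    simp [cutoff, this]

end VolumePreservation

/-! ### Trapping regions contain vertices; chains between a point and its support. -/

section TrappingRegions

set_option linter.unusedSectionVars false

variable {ι : Type*} [Fintype ι] [DecidableEq ι]
  {S : ι → Type*} [∀ i, Fintype (S i)] [∀ i, DecidableEq (S i)]
  {u : (∀ i, S i) → ι → ℝ} {φ : Flow ℝ (strategySpace S)}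

theorem continuous_time_map (φ : Flow ℝ (strategySpace S)) (t : ℝ) : Continuous fun x => φ t x :=
  φ.cont'.comp (continuous_const.prodMk continuous_id)

theorem isClosed_setOf_supportLE (z : strategySpace S) : IsClosed {w | SupportLE w z} := by
  simp only [SupportLE, ofPred_forall]
  exact isClosed_iInter fun i => isClosed_iInter fun s => isClosed_iInter fun _ =>
    isClosed_eq (continuous_coord i s) continuous_const

theorem SameSupport.supportLE {x y : strategySpace S} (h : SameSupport x y) : SupportLE x y :=
  fun i s hs => le_antisymm (not_lt.1 fun h' => ((h i s).1 h').ne' hs) (coord_nonneg x i s)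

theorem SupportLE.pos {x y : strategySpace S} (h : SupportLE x y) {i : ι} {s : S i}
    (hs : 0 < x.1 i s) : 0 < y.1 i s :=
  lt_of_le_of_ne (coord_nonneg y i s) fun h' => hs.ne' (h i s h'.symm)

/-- A nonempty set of mixed profiles contains one whose support is minimal. -/
theorem exists_minimal_support {A : Set (strategySpace S)} (hA : A.Nonempty) :
    ∃ z ∈ A, ∀ w ∈ A, SupportLE w z → SameSupport w z := by
  classical
  let supp : strategySpace S → Finset (Σ i, S i) := fun z =>
    Finset.univ.filter fun b => 0 < z.1 b.1 b.2
  obtain ⟨z, hz, hmin⟩ := (measure fun z => (supp z).card).wf.has_min A hA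
  refine ⟨z, hz, fun w hw hwz => ?_⟩
  have hsub : supp w ⊆ supp z := fun b hb => by
    simp only [supp, Finset.mem_filter_univ] at hb ⊢
    exact hwz.pos hb
  have heq : supp w = supp z := Finset.eq_of_subset_of_card_le hsub (not_lt.1 (hmin w hw))
  intro i s
  have := Finset.ext_iff.1 heq ⟨i, s⟩
  simpa [supp] using this

/-- The relative interior of a face is dense in the face, seen from a vertex. -/
theorem pureProfile_mem_of_isCompact {K : Set (strategySpace S)} (hK : IsCompact K)
    {z : strategySpace S} (hz : ∀ x, SameSupport x z → x ∈ K) {p : ∀ i, S i}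
    (hp : SupportLE (pureProfile p) z) : pureProfile p ∈ K := by
  have hcl : IsClosed (Subtype.val '' K) := (hK.image continuous_subtype_val).isClosed
  -- Every point strictly between `z` and a vertex of its face has the support of `z`.
  have hseg : openSegment ℝ z.1 (pureProfile p).1 ⊆ Subtype.val '' K := by
    rintro w ⟨α, β, hα, hβ, hαβ, rfl⟩
    have hw : α • z.1 + β • (pureProfile p).1 ∈ strategySpace S := fun i =>
      convex_stdSimplex ℝ (S i) (z.2 i) ((pureProfile p).2 i) hα.le hβ.le hαβ
    refine ⟨⟨_, hw⟩, hz _ fun i s => ?_, rfl⟩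
    have h1 := coord_nonneg z i s
    have h2 := coord_nonneg (pureProfile p) i s
    simp only [Pi.add_apply, Pi.smul_apply, smul_eq_mul]
    constructor
    · intro h
      refine lt_of_le_of_ne h1 fun h0 => ?_
      rw [← h0, hp i s h0.symm] at h
      simp at h
    · intro h
      have := mul_pos hα h
      positivity
  have h1 := closure_minimal hseg hcl
    (segment_subset_closure_openSegment (right_mem_segment ℝ z.1 (pureProfile p).1))
  obtain ⟨w, hw, hwp⟩ := h1
  rwa [← Subtype.ext hwp]

/-- A set that contains a uniform neighbourhood of its own image under some time map of the
replicator flow meets the vertices of every face that it meets. -/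
theorem IsReplicatorFlow.exists_pureProfile_mem (hφ : IsReplicatorFlow u φ)
    {U : Set (strategySpace S)} {ε τ : ℝ} (hε : 0 < ε)
    (hU : ∀ y ∈ U, Metric.ball (φ τ y) ε ⊆ U) {x : strategySpace S} (hx : x ∈ U) :
    ∃ p, pureProfile p ∈ U ∧ SupportLE (pureProfile p) x := by
  have hcl : ∀ y ∈ closure U, Metric.ball (φ τ y) ε ⊆ U := by
    intro y hy w hw
    have hopen : IsOpen {y | dist w (φ τ y) < ε} :=
      isOpen_lt (continuous_const.dist (continuous_time_map φ τ)) continuous_const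
    obtain ⟨y', hy', hyU⟩ := mem_closure_iff.1 hy _ hopen hw
    exact hU y' hyU hy'
  -- Minimality keeps the closure of `U` off the proper subfaces of the face of `z`, so `K` is
  -- compact inside the relative interior.
  obtain ⟨z, ⟨hzU, hzx⟩, hmin⟩ := exists_minimal_support
    (A := closure U ∩ {w | SupportLE w x}) ⟨x, subset_closure hx, fun _ _ h => h⟩
  set K := closure U ∩ {w | SupportLE w z} with hKdef
  have hKc : IsCompact K := (isClosed_closure.inter (isClosed_setOf_supportLE z)).isCompact
  have hKz : ∀ w ∈ K, SameSupport w z := fun w hw =>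
    hmin w ⟨hw.1, SupportLE.trans hw.2 hzx⟩ hw.2
  have hzK : z ∈ K := ⟨hzU, fun _ _ h => h⟩
  set I := (fun y => φ τ y) '' K with hI
  have hIne : I.Nonempty := ⟨_, z, hzK, rfl⟩
  -- This bump is `1` on the image of `K` and vanishes at distance `ε` or more from it, while the
  -- open `ε`-neighbourhood of the image lies in `U`.
  set g : strategySpace S → ℝ := fun w => max 0 (1 - ε⁻¹ * Metric.infDist w I) with hg
  have hgl : ∃ C, LipschitzWith C g := by
    have h1 := (lipschitzWith_smul ε⁻¹ (β := ℝ)).comp (Metric.lipschitz_infDist_pt I)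
    exact ⟨_, ((LipschitzWith.const (1 : ℝ)).sub h1).const_max 0⟩
  obtain ⟨C, hgl⟩ := hgl
  have hg0 : ∀ w, SameSupport w z → w ∉ K → g w = 0 := by
    intro w hw hwK
    by_contra hne
    refine hwK ⟨subset_closure ?_, hw.supportLE⟩
    have hlt : Metric.infDist w I < ε := by
      by_contra! hge
      refine hne (max_eq_left ?_)
      have := mul_le_mul_of_nonneg_left hge (inv_pos.2 hε).le
      rw [inv_mul_cancel₀ hε.ne'] at this
      linarith
    obtain ⟨_, ⟨y, hy, rfl⟩, hyw⟩ := (Metric.infDist_lt_iff hIne).1 hlt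
    exact hcl y hy.1 hyw
  have hg1 : ∀ w ∈ K, g (φ τ w) = 1 := by
    intro w hw
    have : Metric.infDist (φ τ w) I = 0 := Metric.infDist_zero_of_mem ⟨w, hw, rfl⟩
    simp [hg, this]
  have hgle : ∀ w, g w ≤ 1 := fun w => max_le zero_le_one (by
    have := mul_nonneg (inv_pos.2 hε).le (Metric.infDist_nonneg (x := w) (s := I))
    linarith)
  have hinv : ∀ w, SameSupport w z → g (φ τ w) = g w := fun w hw =>
    hφ.eq_of_le hgl hKc hKz hg0 (fun w hw => by
      by_cases hwK : w ∈ K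
      · rw [hg1 w hwK]
        exact hgle w
      · rw [hg0 w hw hwK]
        exact le_max_left _ _) hw
  -- Invariance makes `g` equal to `1` on `K` and `0` off it, so a proper `K` would contradict the
  -- intermediate value theorem in the softmax chart.
  have hall : ∀ w, SameSupport w z → w ∈ K := by
    intro w hw
    by_contra hwK
    have hcont : Continuous fun y => g (softmax z y) :=
      hgl.continuous.comp (lipschitzWith_softmax z).continuous
    choose o ho using fun i => exists_coord_pos z i
    obtain ⟨y, hy⟩ := mem_range_of_exists_le_of_exists_ge (c := (1 / 2 : ℝ)) hcont
      ⟨logCoord z o w 0, by rw [softmax_logCoord hw, hg0 w hw hwK]; norm_num⟩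
      ⟨logCoord z o (φ τ z) 0, by
        rw [softmax_logCoord (hφ.sameSupport (hKz z hzK) τ), hg1 z hzK]; norm_num⟩
    have hys := sameSupport_softmax z y
    have hyK : softmax z y ∈ K := by
      by_contra hn
      simp only [hg0 _ hys hn] at hy
      norm_num at hy
    have h1 := hinv _ hys
    rw [hg1 _ hyK] at h1
    simp only [← h1] at hy
    norm_num at hy
  choose p hp using fun i => exists_coord_pos z i
  have hpz : SupportLE (pureProfile p) z := by
    intro i s hs
    have : s ≠ p i := by
      rintro rfl
      exact (hp i).ne' hs
    simp [pureProfile_apply, this]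
  have hpK := pureProfile_mem_of_isCompact hKc hall hpz
  -- The vertex lies in the closure of `U` and is its own image, so the ball around it is contained
  -- in `U`.
  refine ⟨p, hcl _ hpK.1 ?_, hpz.trans hzx⟩
  rw [hφ.pureProfile_fixed]
  exact Metric.mem_ball_self hε

/-- The set of chain-reachable points is trapping because one more step extends any chain. The point
`φ T x` serves as its member, as `x` itself need not be reachable. -/
theorem IsReplicatorFlow.exists_hasChain_to_pureProfile (hφ : IsReplicatorFlow u φ)
    (x : strategySpace S) {ε T : ℝ} (hε : 0 < ε) :
    ∃ p, SupportLE (pureProfile p) x ∧ HasChain φ ε T x (pureProfile p) := by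
  obtain ⟨p, hp, hpx⟩ := hφ.exists_pureProfile_mem (U := {y | HasChain φ ε T x y}) (τ := T) hε
    (fun y hy w hw => Relation.TransGen.tail hy ⟨T, le_rfl, by rwa [dist_comm]⟩)
    (x := φ T x) (Relation.TransGen.single ⟨T, le_rfl, by rwa [dist_self]⟩)
  exact ⟨p, hpx.trans (hφ.supportLE x T), hp⟩

theorem IsReplicatorFlow.exists_hasChain_from_pureProfile (hφ : IsReplicatorFlow u φ)
    (x : strategySpace S) {ε T : ℝ} (hε : 0 < ε) :
    ∃ p, SupportLE (pureProfile p) x ∧ HasChain φ ε T (pureProfile p) x := by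
  -- The points with a chain to `x` form a trapping set for time `-T`: a `δ`-error before flowing
  -- for time `T` becomes an error below `ε` after it.
  obtain ⟨δ, hδ, hδε⟩ := Metric.uniformContinuous_iff.1
    (CompactSpace.uniformContinuous_of_continuous (continuous_time_map φ T)) ε hε
  have hback : ∀ y, φ T (φ (-T) y) = y := fun y => by simp [← Flow.map_add]
  obtain ⟨p, hp, hpx⟩ := hφ.exists_pureProfile_mem (U := {y | HasChain φ ε T y x}) (τ := -T) hδ
    (fun y hy w hw => Relation.TransGen.head ⟨T, le_rfl, by simpa [hback] using hδε hw⟩ hy)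
    (x := φ (-T) x) (Relation.TransGen.single ⟨T, le_rfl, by rwa [hback, dist_self]⟩)
  exact ⟨p, hpx.trans (hφ.supportLE x (-T)), hp⟩

/-- The vertex reached from `x` may vary with `ε` and `T`; it always lies in `W`, where
pseudo-orbits join any two profiles. -/
theorem IsReplicatorFlow.chainEquiv_of_mem_content (hφ : IsReplicatorFlow u φ)
    {W : Set (∀ i, S i)}
    (hW : ∀ p ∈ W, ∀ q ∈ W, PseudoOrbit φ (pureProfile p) (pureProfile q))
    {p : ∀ i, S i} (hp : p ∈ W) {x : strategySpace S} (hx : x ∈ content W) :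
    ChainEquiv φ (pureProfile p) x := by
  have hmem : ∀ q, SupportLE (pureProfile q) x → q ∈ W := fun q hq =>
    hx q fun i => hq.pos (by simp [pureProfile_apply])
  refine ⟨fun ε hε T hT => ?_, fun ε hε T hT => ?_⟩
  · obtain ⟨q, hq, hc⟩ := hφ.exists_hasChain_from_pureProfile x (T := T) hε
    exact Relation.TransGen.trans (hW p hp q (hmem q hq) ε hε T hT) hc
  · obtain ⟨q, hq, hc⟩ := hφ.exists_hasChain_to_pureProfile x (T := T) hε
    exact Relation.TransGen.trans hc (hW q (hmem q hq) p hp ε hε T hT)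

end TrappingRegions

end ReplicatorGame

open ReplicatorGame in
/-- Let `H` be a strongly connected component of the response graph of `u`. Exactly one chain
component of the replicator flow contains the pure profiles in `H`, and it contains the content
of `H`. -/
theorem mainTheorem2 {ι : Type*} [Fintype ι] [DecidableEq ι]
    {S : ι → Type*} [∀ i, Fintype (S i)] [∀ i, DecidableEq (S i)]
    (u : (∀ i, S i) → ι → ℝ) (H : Set (∀ i, S i))
    (hH : IsStronglyConnectedComponent (responseGraph u) H) :
    (∃! C : Set (strategySpace S),
      IsChainComponent (replicatorFlow u) C ∧ pureProfile '' H ⊆ C) ∧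
    ∀ C : Set (strategySpace S), IsChainComponent (replicatorFlow u) C → pureProfile '' H ⊆ C →
      content H ⊆ C := by
  have hφ := isReplicatorFlow_replicatorFlow u
  obtain ⟨p, rfl⟩ := hH
  set H := {q | Reachable (responseGraph u) p q ∧ Reachable (responseGraph u) q p} with hHdef
  have hp : p ∈ H := ⟨Relation.ReflTransGen.refl, Relation.ReflTransGen.refl⟩
  have hW : ∀ q ∈ H, ∀ r ∈ H,
      PseudoOrbit (replicatorFlow u) (pureProfile q) (pureProfile r) := fun q hq r hr =>
    hφ.pseudoOrbit_of_reachable (Relation.ReflTransGen.trans hq.2 hr.1)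
  refine ⟨⟨{y | ChainEquiv (replicatorFlow u) (pureProfile p) y},
    ⟨⟨pureProfile p, ⟨hW p hp p hp, hW p hp p hp⟩, rfl⟩, ?_⟩, ?_⟩, ?_⟩
  · rintro _ ⟨q, hq, rfl⟩
    exact ⟨hW p hp q hq, hW q hq p hp⟩
  · rintro C ⟨hC, hHC⟩
    -- A chain component is the class of each of its points, in particular of the vertex `p`.
    exact hC.eq_setOf_chainEquiv (hHC ⟨p, hp, rfl⟩)
  · intro C hC hHC x hx
    rw [hC.eq_setOf_chainEquiv (hHC ⟨p, hp, rfl⟩)]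
    exact hφ.chainEquiv_of_mem_content hW hp hx
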